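/- Theorem 1.3. Let $n\ge 1$ be an integer. Let $$\Phi(x,t)=\begin{cases}(4\pi t)^{-n/2}e^{-|x|^2/(4t)} & \text{for } x\in\mathbb R^n,\ t>0,\\ 0 & \text{for } x\in\mathbb R^n,\ t\le 0\end{cases}$$ be the heat kernel, let $Hu=u_t-\Delta u$ be the heat operator, and for a positive function $u$ on $\mathbb R^n\times(0,1)$ let $$(\Phi^{\alpha/n}*u^\lambda)(x,t)=\iint_{\mathbb R^n\times(0,1)}\Phi(x-y,t-s)^{\alpha/n}\,u(y,s)^\lambda\,dy\,ds .$$ For $\alpha\in(0,n+2)$ and $\lambda>0$ define $$G_\alpha(\lambda)=\begin{cases}\dfrac{2(n+2)-\alpha}{n}-\lambda & \text{if } 0<\lambda<\dfrac{n+2}{n},\\[2mm] \max\Bigl\{0,\,1-\dfrac{\alpha-2}{n+2}\lambda\Bigr\} & \text{if } \lambda\ge\dfrac{n+2}{n}.\end{cases}$$ Suppose $\alpha,\lambda,\sigma$ are real constants with $\alpha\in(0,n+2)$, $\lambda>0$ and $\sigma>G_\alpha(\lambda)$. Let $\varphi:(0,1)\to(0,\infty)$ be a continuous function satisfying $\lim_{t\to0^+}\varphi(t)=\infty$.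 Then there exists a positive function $$u\in C^\infty(\mathbb R^n\times(0,1))\cap L^\lambda(\mathbb R^n\times(0,1))$$ satisfying $$0\le Hu\le(\Phi^{\alpha/n}*u^\lambda)\,u^\sigma\quad\text{in }\mathbb R^n\times(0,1)$$ such that $$u(0,t)\ne O(\varphi(t))\quad\text{as }t\to0^+ .$$ Consequently no a priori pointwise bound exists: for every nonempty open set $\Omega\subset\mathbb R^n$ there is no continuous function $\varphi:(0,1)\to(0,\infty)$ such that for every positive function $u\in C^\infty(\mathbb R^n\times(0,1))\cap L^\lambda(\mathbb R^n\times(0,1))$ satisfying $0\le Hu\le(\Phi^{\alpha/n}*u^\lambda)u^\sigma$ in $\Omega\times(0,1)$ and every compact set $K\subset\Omega$ one has $\max_{x\in K}u(x,t)=O(\varphi(t))$ as $t\to0^+$. -/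

import Mathlib

open Set Filter Topology MeasureTheory Asymptotics
open scoped ENNReal ContDiff

noncomputable section

namespace Choquard

/-- The heat kernel `Φ(x,t) = (4πt)^{-n/2} exp(-|x|²/(4t))` for `t > 0`, and `0` for `t ≤ 0`. -/
def heatKernel {n : ℕ} (x : EuclideanSpace ℝ (Fin n)) (t : ℝ) : ℝ :=
  if 0 < t then
    1 / (4 * Real.pi * t) ^ ((n : ℝ) / 2) * Real.exp (-(‖x‖ ^ 2 / (4 * t)))
  else 0

/-- The heat operator `Hu = u_t - Δu`, with `Δ` the Laplacian in the space variable. -/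
def heatOp {n : ℕ} (u : EuclideanSpace ℝ (Fin n) → ℝ → ℝ)
    (x : EuclideanSpace ℝ (Fin n)) (t : ℝ) : ℝ :=
  deriv (fun s => u x s) t - Laplacian.laplacian (fun y => u y t) x

/-- The slab `Ω × (0,T)` in `ℝⁿ × ℝ`. -/
def slab {n : ℕ} (Ω : Set (EuclideanSpace ℝ (Fin n))) (T : ℝ) :
    Set (EuclideanSpace ℝ (Fin n) × ℝ) :=
  Ω ×ˢ Ioo 0 T

/-- The convolution
`(Φ^{α/n} * u^λ)(x,t) = ∬_{ℝⁿ × (0,T)} Φ(x-y,t-s)^{α/n} u(y,s)^λ dy ds`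
of nonnegative functions, with values in `[0,∞]`. -/
def heatConv {n : ℕ} (α lam T : ℝ) (u : EuclideanSpace ℝ (Fin n) → ℝ → ℝ)
    (x : EuclideanSpace ℝ (Fin n)) (t : ℝ) : ℝ≥0∞ :=
  ∫⁻ p in slab (univ : Set (EuclideanSpace ℝ (Fin n))) T,
    ENNReal.ofReal (heatKernel (x - p.1) (t - p.2) ^ (α / (n : ℝ)) * u p.1 p.2 ^ lam)

/-- The continuous piecewise linear function `G_α : (0,∞) → [0,∞)` in dimension `n`. -/
def bigG (n : ℕ) (α lam : ℝ) : ℝ :=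
  if lam < ((n : ℝ) + 2) / n then (2 * ((n : ℝ) + 2) - α) / n - lam
  else max 0 (1 - (α - 2) / ((n : ℝ) + 2) * lam)

/-- `u` is a positive function in `C^∞(ℝⁿ × (0,T)) ∩ L^λ(ℝⁿ × (0,T))` that satisfies
`0 ≤ Hu ≤ (Φ^{α/n} * u^λ) u^σ` in `Ω × (0,T)`. Only the values of `u` on `ℝⁿ × (0,T)` matter. -/
structure IsPosSmoothSolution {n : ℕ} (α lam σ : ℝ) (Ω : Set (EuclideanSpace ℝ (Fin n)))
    (T : ℝ) (u : EuclideanSpace ℝ (Fin n) → ℝ → ℝ) : Prop where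
  smooth : ContDiffOn ℝ ∞ (fun p : EuclideanSpace ℝ (Fin n) × ℝ => u p.1 p.2) (slab univ T)
  pos : ∀ x, ∀ t ∈ Ioo 0 T, 0 < u x t
  memLp : MemLp (fun p : EuclideanSpace ℝ (Fin n) × ℝ => u p.1 p.2) (ENNReal.ofReal lam)
    (volume.restrict (slab univ T))
  heatOp_nonneg : ∀ x ∈ Ω, ∀ t ∈ Ioo 0 T, 0 ≤ heatOp u x t
  heatOp_le : ∀ x ∈ Ω, ∀ t ∈ Ioo 0 T,
    ENNReal.ofReal (heatOp u x t) ≤ heatConv α lam T u x t * ENNReal.ofReal (u x t ^ σ)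

/-- `max_{x ∈ K} u(x,t) = O(φ(t))` as `t → 0⁺`, for positive `u` and `φ`. -/
def IsBoundOn {n : ℕ} (φ : ℝ → ℝ) (K : Set (EuclideanSpace ℝ (Fin n)))
    (u : EuclideanSpace ℝ (Fin n) → ℝ → ℝ) : Prop :=
  ∃ C : ℝ, ∀ᶠ t in 𝓝[>] (0 : ℝ), ∀ x ∈ K, u x t ≤ C * φ t

end Choquard

end

namespace Choquard

/-! The solution is a superposition of truncated heat kernels, called atoms. An atom of scale `R` is
a heat kernel of mass `R ^ ((n - a) / 2)` switched on smoothly between the ages `R` and `2 * R`. At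
ages comparable to `R` its height near the centre is of order `R ^ (-a / 2)`, and `H` of it is
nonnegative, lives only on those ages, and has size at most of order `R ^ (-(a / 2 + 1))`.

The nonlinearity lets an atom of scale `R` pay for an atom of scale `κ * R` whose pole comes `3 * R`
later. On the source of the second atom the first makes `(Φ^{α/n} * u^λ) u^σ` at least of order `R ^
(-(α + a (λ + σ) - n - 2) / 2)` times a Gaussian of width about `√R`. A small `κ` makes the new
source narrower than this Gaussian, and the ratio of sizes is `C * R ^ η` with `η > 0` exactly when
`n + 4 - α < a (λ + σ - 1)` (`exists_heatOp_atom_le_heatConv`). The hypothesis `σ > G_α(λ)` allows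
such an `a` with also `a < n` (masses tend to `0` with the scale) and `a λ < n + 2` (integrability),
see `exists_rate`.

Iterating gives chains with scales `r, κ r, κ² r, ...`. The pole times of a chain converge
geometrically and stay below `2 r`, whereas the heights grow without bound, so a chain of sufficient
finite length exceeds any prescribed value at a time in `[r, 2 r]`. The chains with `r = ρ * κ ^ j`
are superposed, the `j`-th long enough to beat `j * φ` on its interval. For small `ρ` the ratios sum
to at most `1`, so all sources together are admissible. Only finitely many atoms are non-caloric
near a point of positive time, which gives smoothness. -/

theorem two_le_infty : (2 : WithTop ℕ∞) ≤ (∞ : WithTop ℕ∞) :=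
  WithTop.coe_le_coe.2 (le_top : ((2 : ℕ) : ℕ∞) ≤ ⊤)

theorem summable_translate {V ι : Type*} [NormedAddCommGroup V] {Ψ : V → ℝ}
    (hΨ : Continuous Ψ) (hc : HasCompactSupport Ψ)
    {m : ι → ℝ} (hm : Summable fun i => |m i|) (a : ι → V) (p : V) :
    Summable fun i => m i * Ψ (p - a i) := by
  obtain ⟨C, hC⟩ := hc.exists_bound_of_continuous hΨ
  refine Summable.of_norm_bounded (hm.mul_right C) fun i => ?_
  rw [norm_mul, Real.norm_eq_abs]
  exact mul_le_mul_of_nonneg_left (hC _) (abs_nonneg _)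

/-! ### Derivatives of infinite sums of translates -/

section TranslateSums

variable {V : Type*} [NormedAddCommGroup V] [NormedSpace ℝ V] {ι : Type*}

theorem exists_bound_iteratedFDeriv {Ψ : V → ℝ} (hΨ : ContDiff ℝ ∞ Ψ)
    (hc : HasCompactSupport Ψ) (k : ℕ) : ∃ C, ∀ x, ‖iteratedFDeriv ℝ k Ψ x‖ ≤ C :=
  (hc.iteratedFDeriv k).exists_bound_of_continuous
    (hΨ.continuous_iteratedFDeriv (by exact_mod_cast le_top))

theorem norm_iteratedFDeriv_smul_translate_le {Ψ : V → ℝ} (hΨ : ContDiff ℝ ∞ Ψ) {k : ℕ} {C : ℝ}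
    (hC : ∀ x, ‖iteratedFDeriv ℝ k Ψ x‖ ≤ C) (m : ℝ) (a x : V) :
    ‖iteratedFDeriv ℝ k (fun p => m * Ψ (p - a)) x‖ ≤ C * |m| := by
  have h : iteratedFDeriv ℝ k (fun p => m * Ψ (p - a)) x
      = m • iteratedFDeriv ℝ k (fun p => Ψ (p - a)) x := by
    have hd : ContDiff ℝ k (fun p => Ψ (p - a)) :=
      (hΨ.of_le (by exact_mod_cast le_top)).comp (contDiff_id.sub contDiff_const)
    exact iteratedFDeriv_const_smul_apply (a := m) hd.contDiffAt
  rw [h, norm_smul, iteratedFDeriv_comp_sub, mul_comm, Real.norm_eq_abs]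
  exact mul_le_mul_of_nonneg_right (hC _) (abs_nonneg _)

/-- Each derivative of `Ψ` is bounded, and translation preserves the bound, so the Weierstrass test
applies with majorants `C k * |m i|`, wherever the centres `a i` lie. -/
theorem contDiff_tsum_translate {Ψ : V → ℝ} (hΨ : ContDiff ℝ ∞ Ψ) (hc : HasCompactSupport Ψ)
    {m : ι → ℝ} (hm : Summable fun i => |m i|) (a : ι → V) :
    ContDiff ℝ ∞ fun p => ∑' i, m i * Ψ (p - a i) := by
  choose C hC using exists_bound_iteratedFDeriv hΨ hc
  refine contDiff_tsum (v := fun k i => C k * |m i|) (fun i => ?_) (fun k _ => hm.mul_left _)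
    fun k i x _ => norm_iteratedFDeriv_smul_translate_le hΨ (hC k) _ _ _
  exact contDiff_const.mul (hΨ.comp (contDiff_id.sub contDiff_const))

theorem fderiv_tsum_translate {Ψ : V → ℝ} (hΨ : ContDiff ℝ ∞ Ψ) (hc : HasCompactSupport Ψ)
    {m : ι → ℝ} (hm : Summable fun i => |m i|) (a : ι → V) (p v : V) :
    fderiv ℝ (fun p => ∑' i, m i * Ψ (p - a i)) p v
      = ∑' i, m i * fderiv ℝ Ψ (p - a i) v := by
  obtain ⟨C, hC⟩ := exists_bound_iteratedFDeriv hΨ hc 1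
  have hd : ∀ i, Differentiable ℝ fun p => m i * Ψ (p - a i) := fun i =>
    (contDiff_const.mul (hΨ.comp (contDiff_id.sub contDiff_const))).differentiable (by simp)
  have hb : ∀ i x, ‖fderiv ℝ (fun p => m i * Ψ (p - a i)) x‖ ≤ C * |m i| := fun i x => by
    rw [← norm_iteratedFDeriv_one]
    exact norm_iteratedFDeriv_smul_translate_le hΨ hC _ _ _
  have hs := hm.mul_left C
  rw [fderiv_tsum_apply hs hd hb (x₀ := p) (summable_translate hΨ.continuous hc hm a p)]
  rw [← ContinuousLinearMap.apply_apply (𝕜 := ℝ) v (∑' i, _), ContinuousLinearMap.map_tsum]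
  · refine tsum_congr fun i => ?_
    rw [ContinuousLinearMap.apply_apply, fderiv_const_mul, fderiv_comp_sub]
    · simp
    · exact ((hΨ.comp (contDiff_id.sub contDiff_const)).differentiable (by simp)) p
  · exact Summable.of_norm_bounded hs fun i => hb i p

end TranslateSums

/-! ### The heat operator on space-time functions -/

section HeatOp

variable {n : ℕ}

local notation "E" => EuclideanSpace ℝ (Fin n)

/-- The second derivative of `F` at `p` in the direction `v`. -/
noncomputable def secondDeriv {V : Type*} [NormedAddCommGroup V] [NormedSpace ℝ V]
    (F : V → ℝ) (p v : V) : ℝ :=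
  fderiv ℝ (fun q => fderiv ℝ F q v) p v

/-- Directional derivatives in space-time pass through sums of translates; this form transfers that
property to `heatOp`. -/
theorem heatOp_eq {F : E × ℝ → ℝ} {x : E} {t : ℝ} (hF : ContDiffAt ℝ 2 F (x, t)) :
    heatOp (fun x t => F (x, t)) x t = fderiv ℝ F (x, t) (0, 1)
      - ∑ i, secondDeriv F (x, t) (EuclideanSpace.basisFun (Fin n) ℝ i, 0) := by
  unfold heatOp
  congr 1
  · have h1 : HasFDerivAt F (fderiv ℝ F (x, t)) (x, t) :=
      (hF.differentiableAt (by simp)).hasFDerivAt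
    have h2 : HasDerivAt (fun s : ℝ => (x, s)) ((0 : E), (1 : ℝ)) t :=
      (hasDerivAt_const t x).prodMk (hasDerivAt_id t)
    exact (h1.comp_hasDerivAt t h2).deriv
  · rw [InnerProductSpace.laplacian_eq_iteratedFDeriv_orthonormalBasis _
      (EuclideanSpace.basisFun (Fin n) ℝ)]
    refine Finset.sum_congr rfl fun i _ => ?_
    rw [iteratedFDeriv_two_apply]
    set e := EuclideanSpace.basisFun (Fin n) ℝ i
    have hsl : ∀ y, HasFDerivAt (fun y : E => (y, t)) (ContinuousLinearMap.inl ℝ E ℝ) y :=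
      fun y => by
        have := (hasFDerivAt_id (𝕜 := ℝ) y).prodMk (hasFDerivAt_const t y)
        exact this
    have hd : ∀ᶠ q in 𝓝 (x, t), DifferentiableAt ℝ F q :=
      (hF.eventually (by simp)).mono fun q hq => hq.differentiableAt (by simp)
    have hcont : ContinuousAt (fun y : E => (y, t)) x := by fun_prop
    have h1 : (fun y => fderiv ℝ (fun y => F (y, t)) y)
        =ᶠ[𝓝 x] fun y => (fderiv ℝ F (y, t)).comp (ContinuousLinearMap.inl ℝ E ℝ) := by
      filter_upwards [hcont.eventually hd] with y hy
      exact (hy.hasFDerivAt.comp y (hsl y)).fderiv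
    have hF' : DifferentiableAt ℝ (fderiv ℝ F) (x, t) :=
      (hF.fderiv_right (m := 1) (by norm_num)).differentiableAt (by simp)
    have h2 : HasFDerivAt (fun q => fderiv ℝ F q (e, 0))
        (((ContinuousLinearMap.apply ℝ ℝ ((e, 0) : E × ℝ))).comp (fderiv ℝ (fderiv ℝ F) (x, t)))
        (x, t) :=
      (ContinuousLinearMap.apply ℝ ℝ ((e, 0) : E × ℝ)).hasFDerivAt.comp (x, t) hF'.hasFDerivAt
    have h3 : HasFDerivAt (fun y => fderiv ℝ F (y, t))
        ((fderiv ℝ (fderiv ℝ F) (x, t)).comp (ContinuousLinearMap.inl ℝ E ℝ)) x :=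
      hF'.hasFDerivAt.comp x (hsl x)
    let L : (E × ℝ →L[ℝ] ℝ) →L[ℝ] (E →L[ℝ] ℝ) :=
      ContinuousLinearMap.precomp ℝ (ContinuousLinearMap.inl ℝ E ℝ)
    have h4 : HasFDerivAt (fun y => (fderiv ℝ F (y, t)).comp (ContinuousLinearMap.inl ℝ E ℝ))
        (L.comp ((fderiv ℝ (fderiv ℝ F) (x, t)).comp (ContinuousLinearMap.inl ℝ E ℝ))) x :=
      L.hasFDerivAt.comp x h3
    have h5 := (h4.congr_of_eventuallyEq h1).fderiv
    unfold secondDeriv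
    rw [h2.fderiv]
    change (fderiv ℝ (fderiv ℝ fun y => F (y, t)) x) e e = _
    rw [h5]
    simp [L]

theorem secondDeriv_tsum_translate {V ι : Type*} [NormedAddCommGroup V] [NormedSpace ℝ V]
    {Ψ : V → ℝ} (hΨ : ContDiff ℝ ∞ Ψ) (hc : HasCompactSupport Ψ)
    {m : ι → ℝ} (hm : Summable fun i => |m i|) (a : ι → V) (p v : V) :
    secondDeriv (fun p => ∑' i, m i * Ψ (p - a i)) p v
      = ∑' i, m i * secondDeriv Ψ (p - a i) v := by
  unfold secondDeriv
  simp_rw [fderiv_tsum_translate hΨ hc hm]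
  exact fderiv_tsum_translate
    ((hΨ.fderiv_right (m := ∞) (by simp)).clm_apply contDiff_const)
    (hc.fderiv_apply (𝕜 := ℝ) v) hm a p v

/-- A superposition of translates of `Ψ` is caloric wherever all the translates are. -/
theorem heatOp_tsum_translate_eq_zero {ι : Type*} {Ψ : E × ℝ → ℝ} (hΨ : ContDiff ℝ ∞ Ψ)
    (hc : HasCompactSupport Ψ) {m : ι → ℝ} (hm : Summable fun i => |m i|) (a : ι → E × ℝ)
    (x : E) (t : ℝ)
    (h0 : ∀ i, heatOp (fun x t => Ψ (x, t)) (x - (a i).1) (t - (a i).2) = 0) :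
    heatOp (fun x t => ∑' i, m i * Ψ ((x, t) - a i)) x t = 0 := by
  have hS := contDiff_tsum_translate hΨ hc hm a
  rw [heatOp_eq (F := fun p => ∑' i, m i * Ψ (p - a i)) 
      (hS.of_le two_le_infty).contDiffAt,
    fderiv_tsum_translate hΨ hc hm]
  simp_rw [secondDeriv_tsum_translate hΨ hc hm]
  have hD : ∀ v, ContDiff ℝ ∞ fun q => fderiv ℝ Ψ q v := fun v =>
    (hΨ.fderiv_right (m := ∞) (by simp)).clm_apply contDiff_const
  have hDc : ∀ v, HasCompactSupport fun q => fderiv ℝ Ψ q v := fun v =>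
    hc.fderiv_apply (𝕜 := ℝ) v
  have hs2 : ∀ v, Summable fun i => m i * secondDeriv Ψ ((x, t) - a i) v := fun v =>
    summable_translate (Ψ := fun q => secondDeriv Ψ q v)
      (((hD v).fderiv_right (m := ∞) (by simp)).clm_apply contDiff_const).continuous
      ((hDc v).fderiv_apply (𝕜 := ℝ) v) hm a _
  have hs1 : ∀ v, Summable fun i => m i * fderiv ℝ Ψ ((x, t) - a i) v := fun v =>
    summable_translate (hD v).continuous (hDc v) hm a _
  rw [← Summable.tsum_finsetSum fun i _ => hs2 _, ← Summable.tsum_sub (hs1 _)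
    (summable_sum fun i _ => hs2 _)]
  convert tsum_zero with i
  rw [← Finset.mul_sum, ← mul_sub]
  have := h0 i
  rw [heatOp_eq (hΨ.of_le two_le_infty).contDiffAt] at this
  rw [show (x, t) - a i = (x - (a i).1, t - (a i).2) from rfl, this, mul_zero]

theorem heatOp_congr {F G : E × ℝ → ℝ} {x : E} {t : ℝ} (h : F =ᶠ[𝓝 (x, t)] G) :
    heatOp (fun x t => F (x, t)) x t = heatOp (fun x t => G (x, t)) x t := by
  unfold heatOp
  have h1 : Tendsto (fun s : ℝ => (x, s)) (𝓝 t) (𝓝 (x, t)) :=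
    Continuous.tendsto (by fun_prop) t
  have h2 : Tendsto (fun y : E => (y, t)) (𝓝 x) (𝓝 (x, t)) :=
    Continuous.tendsto (by fun_prop) x
  have e1 : (fun s => F (x, s)) =ᶠ[𝓝 t] fun s => G (x, s) := h1.eventually h
  have e2 : (fun y => F (y, t)) =ᶠ[𝓝 x] fun y => G (y, t) := h2.eventually h
  rw [e1.deriv_eq, (InnerProductSpace.laplacian_congr_nhds e2).eq_of_nhds]

theorem heatOp_add {F G : E × ℝ → ℝ} {x : E} {t : ℝ} (hF : ContDiffAt ℝ 2 F (x, t))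
    (hG : ContDiffAt ℝ 2 G (x, t)) :
    heatOp (fun x t => F (x, t) + G (x, t)) x t
      = heatOp (fun x t => F (x, t)) x t + heatOp (fun x t => G (x, t)) x t := by
  unfold heatOp
  have c1 : ContDiffAt ℝ 2 (fun s : ℝ => (x, s)) t := by fun_prop
  have c2 : ContDiffAt ℝ 2 (fun y : E => (y, t)) x := by fun_prop
  have e1 := deriv_fun_add ((hF.comp t c1).differentiableAt (by simp))
    ((hG.comp t c1).differentiableAt (by simp))
  have e2 := (hF.comp x c2).laplacian_add (hG.comp x c2)
  simp only [Function.comp_def] at e1 e2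
  rw [e1, show (fun y => F (y, t) + G (y, t)) = (fun y => F (y, t)) + fun y => G (y, t) from rfl,
    e2]
  ring

theorem heatOp_zero (x : E) (t : ℝ) : heatOp (fun (_ : E) (_ : ℝ) => (0 : ℝ)) x t = 0 := by
  simp [heatOp, InnerProductSpace.laplacian_const]

theorem heatOp_sum {ι : Type*} (s : Finset ι) {F : ι → E × ℝ → ℝ} {x : E} {t : ℝ}
    (hF : ∀ i ∈ s, ContDiffAt ℝ 2 (F i) (x, t)) :
    heatOp (fun x t => ∑ i ∈ s, F i (x, t)) x t = ∑ i ∈ s, heatOp (fun x t => F i (x, t)) x t := by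
  classical
  induction s using Finset.induction_on with
  | empty => simpa using heatOp_zero x t
  | insert a s ha ih =>
    simp only [Finset.sum_insert ha]
    rw [heatOp_add (F := F a) (G := fun p => ∑ i ∈ s, F i p) (hF _ (Finset.mem_insert_self _ _))
      (ContDiffAt.sum fun i hi => hF i (Finset.mem_insert_of_mem hi)),
      ih fun i hi => hF i (Finset.mem_insert_of_mem hi)]

end HeatOp

end Choquard

/-! ### The heat kernel and the atoms -/

namespace Choquard

variable {n : ℕ}

local notation "E" => EuclideanSpace ℝ (Fin n)

theorem heatKernel_of_pos (x : E) {t : ℝ} (ht : 0 < t) :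
    heatKernel x t = 1 / (4 * Real.pi * t) ^ ((n : ℝ) / 2) * Real.exp (-(‖x‖ ^ 2 / (4 * t))) :=
  if_pos ht

theorem heatKernel_pos (x : E) {t : ℝ} (ht : 0 < t) : 0 < heatKernel x t := by
  rw [heatKernel_of_pos x ht]
  positivity

theorem heatKernel_nonneg (x : E) (t : ℝ) : 0 ≤ heatKernel x t := by
  unfold heatKernel
  split_ifs
  · positivity
  · exact le_rfl

theorem contDiffAt_heatKernel (x : E) {t : ℝ} (ht : 0 < t) :
    ContDiffAt ℝ ∞ (fun p : E × ℝ => heatKernel p.1 p.2) (x, t) := by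
  have h : (fun p : E × ℝ => heatKernel p.1 p.2) =ᶠ[𝓝 (x, t)] fun p =>
      1 / (4 * Real.pi * p.2) ^ ((n : ℝ) / 2) * Real.exp (-(‖p.1‖ ^ 2 / (4 * p.2))) := by
    have : ∀ᶠ p : E × ℝ in 𝓝 (x, t), 0 < p.2 :=
      continuousAt_snd.eventually (lt_mem_nhds ht)
    filter_upwards [this] with p hp using heatKernel_of_pos _ hp
  refine ContDiffAt.congr_of_eventuallyEq ?_ h
  have h1 : ContDiffAt ℝ ∞ (fun p : E × ℝ => 4 * Real.pi * p.2) (x, t) :=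
    contDiffAt_const.mul contDiffAt_snd
  have h2 : ContDiffAt ℝ ∞ (fun p : E × ℝ => ‖p.1‖ ^ 2) (x, t) :=
    contDiffAt_fst.norm_sq ℝ
  have h3 : ContDiffAt ℝ ∞ (fun p : E × ℝ => 4 * p.2) (x, t) :=
    contDiffAt_const.mul contDiffAt_snd
  refine ContDiffAt.mul (contDiffAt_const.div (h1.rpow_const_of_ne (by positivity)) ?_) ?_
  · exact (by positivity : (0 : ℝ) < (4 * Real.pi * t) ^ ((n : ℝ) / 2)).ne'
  · exact ((h2.div h3 (by positivity)).neg).exp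

theorem hasDerivAt_heatKernel (x : E) {t : ℝ} (ht : 0 < t) :
    HasDerivAt (fun s => heatKernel x s)
      ((‖x‖ ^ 2 / (4 * t ^ 2) - n / (2 * t)) * heatKernel x t) t := by
  have h : (fun s => heatKernel x s) =ᶠ[𝓝 t] fun s =>
      (4 * Real.pi * s) ^ (-((n : ℝ) / 2)) * Real.exp (-(‖x‖ ^ 2 / (4 * s))) := by
    filter_upwards [lt_mem_nhds ht] with s hs
    rw [heatKernel_of_pos x hs, Real.rpow_neg (by positivity), one_div]
  refine HasDerivAt.congr_of_eventuallyEq ?_ h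
  have h1 : HasDerivAt (fun s => 4 * Real.pi * s) (4 * Real.pi) t := by
    simpa using (hasDerivAt_id t).const_mul (4 * Real.pi)
  have h2 := h1.rpow_const (p := -((n : ℝ) / 2)) (Or.inl (by positivity))
  have h3 : HasDerivAt (fun s => -(‖x‖ ^ 2 / (4 * s))) (‖x‖ ^ 2 / (4 * t ^ 2)) t := by
    have h4 := (hasDerivAt_inv ht.ne').const_mul (-(‖x‖ ^ 2 / 4))
    have hfun : (fun s => -(‖x‖ ^ 2 / (4 * s))) = fun s => -(‖x‖ ^ 2 / 4) * s⁻¹ := by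
      ext s
      rw [div_mul_eq_div_div, div_eq_mul_inv _ s, neg_mul]
    rw [hfun]
    refine h4.congr_deriv ?_
    field_simp
  refine (h2.mul h3.exp).congr_deriv ?_
  rw [h.eq_of_nhds, Real.rpow_sub_one (by positivity)]
  field_simp
  ring

theorem laplacian_heatKernel (c x : E) {t : ℝ} (ht : 0 < t) :
    Laplacian.laplacian (fun y : E => heatKernel (y - c) t) x
      = (‖x - c‖ ^ 2 / (4 * t ^ 2) - n / (2 * t)) * heatKernel (x - c) t := by
  have h1 : ∀ y : E, HasFDerivAt (fun y : E => heatKernel (y - c) t)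
      ((-(1 / (2 * t)) * heatKernel (y - c) t) • innerSL ℝ (y - c)) y := fun y => by
    have e1 : HasFDerivAt (fun y : E => ‖y - c‖ ^ 2) ((2 : ℝ) • innerSL ℝ (y - c)) y := by
      exact ((hasFDerivAt_id y).sub_const c).norm_sq.congr_fderiv (by ext v; simp [two_smul])
    have e2 := ((e1.const_mul (-(1 / (4 * t)))).exp).const_mul
      (1 / (4 * Real.pi * t) ^ ((n : ℝ) / 2))
    have hfun : (fun y : E => heatKernel (y - c) t) = fun y =>
        1 / (4 * Real.pi * t) ^ ((n : ℝ) / 2) * Real.exp (-(1 / (4 * t)) * ‖y - c‖ ^ 2) := by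
      ext y
      rw [heatKernel_of_pos _ ht]
      congr 2
      ring
    rw [hfun]
    refine e2.congr_fderiv ?_
    ext v
    have hy : heatKernel (y - c) t =
        1 / (4 * Real.pi * t) ^ ((n : ℝ) / 2) * Real.exp (-(1 / (4 * t)) * ‖y - c‖ ^ 2) :=
      congrFun hfun y
    rw [hy]
    simp only [_root_.smul_apply, smul_eq_mul]
    ring
  have hf : fderiv ℝ (fun y : E => heatKernel (y - c) t) = fun y =>
      (-(1 / (2 * t)) * heatKernel (y - c) t) • innerSL ℝ (y - c) :=
    funext fun y => (h1 y).fderiv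
  rw [InnerProductSpace.laplacian_eq_iteratedFDeriv_orthonormalBasis _
    (EuclideanSpace.basisFun (Fin n) ℝ)]
  obtain ⟨L, hL⟩ : ∃ L : E →L[ℝ] E →L[ℝ] ℝ, ∀ v, L v = innerSL ℝ v := ⟨innerSL ℝ, fun _ => rfl⟩
  have h2 : HasFDerivAt (fun y : E => innerSL ℝ (y - c)) L x := by
    simp_rw [← hL]
    exact L.hasFDerivAt.comp x ((hasFDerivAt_id x).sub_const c)
  have h3 : HasFDerivAt (fun y : E => (-(1 / (2 * t)) * heatKernel (y - c) t) • innerSL ℝ (y - c))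
      _ x := ((h1 x).const_mul (-(1 / (2 * t)))).smul h2
  have hsum : ∑ i, inner ℝ (x - c) (EuclideanSpace.basisFun (Fin n) ℝ i) ^ 2 = ‖x - c‖ ^ 2 := by
    rw [EuclideanSpace.norm_sq_eq]
    refine Finset.sum_congr rfl fun i _ => ?_
    rw [EuclideanSpace.basisFun_apply, EuclideanSpace.inner_single_right]
    simp
  have hterm : ∀ i, iteratedFDeriv ℝ 2 (fun y : E => heatKernel (y - c) t) x
      ![EuclideanSpace.basisFun (Fin n) ℝ i, EuclideanSpace.basisFun (Fin n) ℝ i]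
      = (1 / (4 * t ^ 2) * inner ℝ (x - c) (EuclideanSpace.basisFun (Fin n) ℝ i) ^ 2
          - 1 / (2 * t)) * heatKernel (x - c) t := fun i => by
    rw [iteratedFDeriv_two_apply]
    change (fderiv ℝ (fderiv ℝ fun y : E => heatKernel (y - c) t) x) _ _ = _
    rw [hf, h3.fderiv]
    have : inner ℝ (EuclideanSpace.basisFun (Fin n) ℝ i) (EuclideanSpace.basisFun (Fin n) ℝ i)
        = (1 : ℝ) := by
      rw [real_inner_self_eq_norm_sq, OrthonormalBasis.norm_eq_one]
      norm_num
    simp only [_root_.add_apply, _root_.smul_apply,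
      ContinuousLinearMap.smulRight_apply, hL, innerSL_apply_apply, smul_eq_mul, Matrix.cons_val_zero,
      Matrix.cons_val_one, this]
    field_simp
    ring
  simp_rw [hterm]
  rw [← Finset.sum_mul, Finset.sum_sub_distrib, ← Finset.mul_sum, hsum]
  rw [Finset.sum_const, Finset.card_univ, Fintype.card_fin, nsmul_eq_mul, mul_one_div,
    one_div_mul_eq_div]

/-- The kernel is caloric and `φ` depends on time alone, so only the derivative falling on `φ`
survives. -/
theorem heatOp_mul_heatKernel (c x : E) {τ t φ' : ℝ} {φ : ℝ → ℝ} (ht : τ < t)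
    (hφ : HasDerivAt φ φ' t) :
    heatOp (fun x t => φ t * heatKernel (x - c) (t - τ)) x t
      = φ' * heatKernel (x - c) (t - τ) := by
  have ht' : 0 < t - τ := sub_pos.2 ht
  have h1 : HasDerivAt (fun s => heatKernel (x - c) (s - τ)) _ t :=
    (hasDerivAt_heatKernel (x - c) ht').comp_sub_const t τ
  have h2 : ContDiffAt ℝ 2 (fun y : E => heatKernel (y - c) (t - τ)) x := by
    have : ContDiffAt ℝ 2 (fun y : E => (y - c, t - τ)) x := by fun_prop
    exact ContDiffAt.comp (g := fun p : E × ℝ => heatKernel p.1 p.2) x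
      ((contDiffAt_heatKernel (x - c) ht').of_le two_le_infty) this
  have h4 : HasDerivAt (fun s => φ s * heatKernel (x - c) (s - τ)) _ t := hφ.mul h1
  unfold heatOp
  rw [h4.deriv]
  have h3 := InnerProductSpace.laplacian_smul (φ t) h2
  rw [laplacian_heatKernel c x ht'] at h3
  change _ - Laplacian.laplacian (φ t • fun y : E => heatKernel (y - c) (t - τ)) x = _
  rw [h3, smul_eq_mul]
  ring

/-- A smooth nondecreasing cutoff equal to `0` on `(-∞, 1]` and to `1` on `[2, ∞)`. -/
noncomputable def cutoff (s : ℝ) : ℝ := Real.smoothTransition (s - 1)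

theorem contDiff_cutoff : ContDiff ℝ ∞ cutoff :=
  Real.smoothTransition.contDiff.comp (contDiff_id.sub contDiff_const)

theorem cutoff_of_le_one {s : ℝ} (hs : s ≤ 1) : cutoff s = 0 :=
  Real.smoothTransition.zero_of_nonpos (by linarith)

theorem cutoff_of_two_le {s : ℝ} (hs : 2 ≤ s) : cutoff s = 1 :=
  Real.smoothTransition.one_of_one_le (by linarith)

theorem cutoff_nonneg (s : ℝ) : 0 ≤ cutoff s := Real.smoothTransition.nonneg _

theorem cutoff_le_one (s : ℝ) : cutoff s ≤ 1 := Real.smoothTransition.le_one _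

theorem deriv_cutoff_nonneg (s : ℝ) : 0 ≤ deriv cutoff s :=
  Monotone.deriv_nonneg (fun _ _ h => Real.smoothTransition.monotone (sub_le_sub_right h 1))

theorem deriv_cutoff_eq_zero {s : ℝ} (hs : s ∉ Icc (1 : ℝ) 2) : deriv cutoff s = 0 := by
  rw [mem_Icc, not_and_or, not_le, not_le] at hs
  rcases hs with hs | hs
  · have : cutoff =ᶠ[𝓝 s] fun _ => 0 := by
      filter_upwards [gt_mem_nhds hs] with r hr using cutoff_of_le_one hr.le
    rw [this.deriv_eq, deriv_const]
  · have : cutoff =ᶠ[𝓝 s] fun _ => 1 := by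
      filter_upwards [lt_mem_nhds hs] with r hr using cutoff_of_two_le hr.le
    rw [this.deriv_eq, deriv_const]

theorem exists_deriv_cutoff_le : ∃ B > 0, ∀ s, deriv cutoff s ≤ B := by
  have hc : HasCompactSupport (deriv cutoff) :=
    HasCompactSupport.intro (isCompact_Icc (a := (1 : ℝ)) (b := 2)) fun s hs =>
      deriv_cutoff_eq_zero hs
  obtain ⟨B, hB⟩ := hc.exists_bound_of_continuous (contDiff_cutoff.continuous_deriv (by simp))
  exact ⟨max B 1, by positivity, fun s =>
    (le_abs_self _).trans ((hB s).trans (le_max_left _ _))⟩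

/-- The supersolution obtained from the heat kernel with pole `(c, τ)`, of mass `R ^ ((n - a) / 2)`,
by switching it on smoothly between the ages `R` and `2 * R`. -/
noncomputable def atom (a : ℝ) (c : E) (R τ : ℝ) (x : E) (t : ℝ) : ℝ :=
  R ^ (((n : ℝ) - a) / 2) * cutoff ((t - τ) / R) * heatKernel (x - c) (t - τ)

variable {a R τ : ℝ} {c : EuclideanSpace ℝ (Fin n)}

theorem atom_nonneg (hR : 0 < R) (x : E) (t : ℝ) : 0 ≤ atom a c R τ x t :=
  mul_nonneg (mul_nonneg (by positivity) (cutoff_nonneg _)) (heatKernel_nonneg _ _)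

theorem atom_le (hR : 0 < R) (x : E) (t : ℝ) :
    atom a c R τ x t ≤ R ^ (((n : ℝ) - a) / 2) * heatKernel (x - c) (t - τ) :=
  mul_le_mul_of_nonneg_right (mul_le_of_le_one_right (by positivity) (cutoff_le_one _))
    (heatKernel_nonneg _ _)

theorem atom_eq_zero (hR : 0 < R) (x : E) {t : ℝ} (ht : t ≤ τ + R) : atom a c R τ x t = 0 := by
  rw [atom, cutoff_of_le_one ((div_le_one hR).2 (by linarith))]
  simp

theorem atom_eq (hR : 0 < R) (x : E) {t : ℝ} (ht : τ + 2 * R ≤ t) :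
    atom a c R τ x t = R ^ (((n : ℝ) - a) / 2) * heatKernel (x - c) (t - τ) := by
  rw [atom, cutoff_of_two_le ((le_div_iff₀ hR).2 (by linarith)), mul_one]

theorem atom_eventuallyEq_zero (hR : 0 < R) (x : E) {t : ℝ} (ht : t < τ + R) :
    (fun p : E × ℝ => atom a c R τ p.1 p.2) =ᶠ[𝓝 (x, t)] fun _ => 0 := by
  have : ∀ᶠ p : E × ℝ in 𝓝 (x, t), p.2 < τ + R := continuousAt_snd.eventually (gt_mem_nhds ht)
  filter_upwards [this] with p hp using atom_eq_zero hR _ hp.le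

theorem contDiff_atom (hR : 0 < R) : ContDiff ℝ ∞ fun p : E × ℝ => atom a c R τ p.1 p.2 := by
  rw [contDiff_iff_contDiffAt]
  rintro ⟨x, t⟩
  rcases lt_or_ge t (τ + R) with ht | ht
  · exact contDiffAt_const.congr_of_eventuallyEq (atom_eventuallyEq_zero hR x ht)
  · have h1 : ContDiffAt ℝ ∞ (fun p : E × ℝ => cutoff ((p.2 - τ) / R)) (x, t) :=
      (contDiff_cutoff.comp ((contDiff_snd.sub contDiff_const).div_const R)).contDiffAt
    have h2 : ContDiffAt ℝ ∞ (fun p : E × ℝ => heatKernel (p.1 - c) (p.2 - τ)) (x, t) :=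
      ContDiffAt.comp (g := fun p : E × ℝ => heatKernel p.1 p.2)
        (f := fun p : E × ℝ => (p.1 - c, p.2 - τ)) (x, t)
        (contDiffAt_heatKernel (x - c) (by linarith : 0 < t - τ)) (by fun_prop)
    exact (contDiffAt_const.mul h1).mul h2

theorem heatOp_atom (hR : 0 < R) (x : E) (t : ℝ) :
    heatOp (atom a c R τ) x t = R ^ (((n : ℝ) - a) / 2) * (deriv cutoff ((t - τ) / R) / R)
      * heatKernel (x - c) (t - τ) := by
  rcases lt_or_ge t (τ + R) with ht | ht
  · have h := heatOp_congr (atom_eventuallyEq_zero (a := a) (c := c) hR x ht)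
    rw [show heatOp (atom a c R τ) x t = heatOp (fun x t => (fun p : E × ℝ =>
      atom a c R τ p.1 p.2) (x, t)) x t from rfl, h, heatOp_zero, deriv_cutoff_eq_zero]
    · simp
    · rw [mem_Icc, not_and_or, not_le]
      exact Or.inl ((div_lt_one hR).2 (by linarith))
  · have h1 : HasDerivAt (fun t => R ^ (((n : ℝ) - a) / 2) * cutoff ((t - τ) / R))
        (R ^ (((n : ℝ) - a) / 2) * (deriv cutoff ((t - τ) / R) / R)) t := by
      have e1 : HasDerivAt (fun t => (t - τ) / R) (1 / R) t :=
        ((hasDerivAt_id t).sub_const τ).div_const R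
      have e2 := ((contDiff_cutoff.differentiable (by simp)) ((t - τ) / R)).hasDerivAt.comp t e1
      refine (e2.const_mul (R ^ (((n : ℝ) - a) / 2))).congr_deriv ?_
      rw [mul_one_div]
    exact heatOp_mul_heatKernel c x (by linarith) h1

theorem heatOp_atom_nonneg (hR : 0 < R) (x : E) (t : ℝ) : 0 ≤ heatOp (atom a c R τ) x t := by
  rw [heatOp_atom hR]
  exact mul_nonneg (mul_nonneg (by positivity) (div_nonneg (deriv_cutoff_nonneg _) hR.le))
    (heatKernel_nonneg _ _)

theorem heatOp_atom_eq_zero (hR : 0 < R) (x : E) {t : ℝ} (ht : t - τ ∉ Icc R (2 * R)) :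
    heatOp (atom a c R τ) x t = 0 := by
  rw [heatOp_atom hR, deriv_cutoff_eq_zero]
  · simp
  · rwa [mem_Icc, le_div_iff₀ hR, div_le_iff₀ hR, one_mul]

end Choquard

/-! ### One atom pays for the next -/

namespace Choquard

variable {n : ℕ}

local notation "E" => EuclideanSpace ℝ (Fin n)

/-- The two Gaussian bounds have different rates, `2 * R` below and `8 * R` above; the ratio `κ` of
consecutive scales absorbs the loss. -/
theorem le_heatKernel {R s : ℝ} (hR : 0 < R) (h1 : R / 2 ≤ s) (h2 : s ≤ 5 * R) (z : E) :
    (20 * Real.pi) ^ (-((n : ℝ) / 2)) * R ^ (-((n : ℝ) / 2)) * Real.exp (-(‖z‖ ^ 2 / (2 * R)))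
      ≤ heatKernel z s := by
  have hs : 0 < s := by linarith
  rw [heatKernel_of_pos z hs, ← Real.mul_rpow (by positivity) hR.le, one_div,
    ← Real.rpow_neg (by positivity)]
  refine mul_le_mul ?_ ?_ (Real.exp_pos _).le (by positivity)
  · refine Real.rpow_le_rpow_of_nonpos (by positivity) ?_ (by simp; positivity)
    nlinarith [Real.pi_pos]
  · rw [Real.exp_le_exp, neg_le_neg_iff]
    exact div_le_div_of_nonneg_left (by positivity) (by positivity) (by linarith)

theorem heatKernel_le {R s : ℝ} (hR : 0 < R) (h1 : R ≤ s) (h2 : s ≤ 2 * R) (z : E) :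
    heatKernel z s ≤ R ^ (-((n : ℝ) / 2)) * Real.exp (-(‖z‖ ^ 2 / (8 * R))) := by
  have hs : 0 < s := by linarith
  rw [heatKernel_of_pos z hs, one_div, ← Real.rpow_neg (by positivity)]
  refine mul_le_mul ?_ ?_ (Real.exp_pos _).le (by positivity)
  · refine Real.rpow_le_rpow_of_nonpos hR ?_ (by simp; positivity)
    nlinarith [Real.pi_gt_three]
  · rw [Real.exp_le_exp, neg_le_neg_iff]
    exact div_le_div_of_nonneg_left (by positivity) (by positivity) (by linarith)

variable {α lam σ a κ R τ : ℝ} {c : EuclideanSpace ℝ (Fin n)}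

theorem le_atom (hR : 0 < R) {s : ℝ} (h1 : τ + 2 * R ≤ s) (h2 : s ≤ τ + 5 * R) (y : E) :
    (20 * Real.pi) ^ (-((n : ℝ) / 2)) * R ^ (-(a / 2)) * Real.exp (-(‖y - c‖ ^ 2 / (2 * R)))
      ≤ atom a c R τ y s := by
  rw [atom_eq hR y h1]
  refine le_trans (le_of_eq ?_) (mul_le_mul_of_nonneg_left
    (le_heatKernel hR (by linarith) (by linarith) (y - c)) (by positivity))
  rw [show -(a / 2) = ((n : ℝ) - a) / 2 + -((n : ℝ) / 2) by ring, Real.rpow_add hR]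
  ring

theorem le_heatConv (hα : 0 < α) (hlam : 0 ≤ lam) (hR : 0 < R) (hτ : -(2 * R) ≤ τ)
    {u : E → ℝ → ℝ} (hu : ∀ x, ∀ t ∈ Ioo (0 : ℝ) 1, atom a c R τ x t ≤ u x t) (x : E) {t : ℝ}
    (ht1 : τ + 3 * R ≤ t) (ht2 : t ≤ τ + 5 * R) (ht : t < 1) :
    ENNReal.ofReal (((20 * Real.pi) ^ (-((n : ℝ) / 2)) * R ^ (-((n : ℝ) / 2))
        * Real.exp (-(‖x - c‖ ^ 2 / R + 1))) ^ (α / (n : ℝ))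
      * ((20 * Real.pi) ^ (-((n : ℝ) / 2)) * R ^ (-(a / 2)) * Real.exp (-(1 / 2))) ^ lam
      * ((volume (Metric.ball (0 : E) 1)).toReal * R ^ ((n : ℝ) / 2) * (R / 2)))
      ≤ heatConv α lam 1 u x t := by
  set A := ((20 * Real.pi) ^ (-((n : ℝ) / 2)) * R ^ (-((n : ℝ) / 2))
        * Real.exp (-(‖x - c‖ ^ 2 / R + 1))) ^ (α / (n : ℝ))
      * ((20 * Real.pi) ^ (-((n : ℝ) / 2)) * R ^ (-(a / 2)) * Real.exp (-(1 / 2))) ^ lam with hA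
  have hA0 : 0 ≤ A := by positivity
  -- On this parabolic box the atom is fully switched on, and `t - s` stays between `R / 2` and `3 *
  -- R`. Its volume supplies the factor `R ^ (n / 2 + 1)`; `τ ≥ -2 * R` keeps it at positive times.
  set S : Set (E × ℝ) := Metric.ball c (R ^ (1 / 2 : ℝ)) ×ˢ Ioo (τ + 2 * R) (τ + 5 / 2 * R)
  have hS : S ⊆ slab univ 1 := by
    rintro ⟨y, s⟩ ⟨-, hs1, hs2⟩
    exact ⟨mem_univ _, by simp only at *; linarith, by simp only at *; linarith⟩
  have hSm : MeasurableSet S := Metric.isOpen_ball.measurableSet.prod measurableSet_Ioo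
  have hvol : volume S = ENNReal.ofReal
      ((volume (Metric.ball (0 : E) 1)).toReal * R ^ ((n : ℝ) / 2) * (R / 2)) := by
    rw [Measure.volume_eq_prod, Measure.prod_prod,
      Measure.addHaar_ball_of_pos _ _ (by positivity), Real.volume_Ioo, finrank_euclideanSpace,
      Fintype.card_fin, ← Real.rpow_natCast, ← Real.rpow_mul hR.le,
      ENNReal.ofReal_mul (by positivity), ENNReal.ofReal_mul (by positivity),
      ENNReal.ofReal_toReal measure_ball_lt_top.ne, mul_comm (ENNReal.ofReal _) (volume _),
      show (1 / 2 : ℝ) * n = n / 2 by ring, show τ + 5 / 2 * R - (τ + 2 * R) = R / 2 by ring]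
  rw [ENNReal.ofReal_mul hA0, ← hvol, ← setLIntegral_const]
  refine le_trans (setLIntegral_mono' hSm ?_) (lintegral_mono_set hS)
  rintro ⟨y, s⟩ hys
  have hs := (hS hys).2
  obtain ⟨hy, hs1, hs2⟩ := hys
  simp only at hy hs1 hs2 hs ⊢
  have hy2 : ‖y - c‖ ^ 2 ≤ R := by
    have h := (mem_ball_iff_norm.1 hy).le
    calc ‖y - c‖ ^ 2 ≤ (R ^ (1 / 2 : ℝ)) ^ 2 := by gcongr
      _ = R := by rw [← Real.rpow_natCast, ← Real.rpow_mul hR.le]; norm_num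
  have hxy : ‖x - y‖ ^ 2 ≤ 2 * ‖x - c‖ ^ 2 + 2 * R := by
    have h : ‖x - y‖ ≤ ‖x - c‖ + ‖y - c‖ := by
      rw [← sub_sub_sub_cancel_right x y c]
      exact norm_sub_le _ _
    nlinarith [sq_nonneg (‖x - c‖ - ‖y - c‖), norm_nonneg (x - y)]
  apply ENNReal.ofReal_le_ofReal
  rw [hA]
  refine mul_le_mul (Real.rpow_le_rpow (by positivity) ?_ (by positivity))
    (Real.rpow_le_rpow (by positivity) ?_ hlam) (by positivity)
    (Real.rpow_nonneg (heatKernel_nonneg _ _) _)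
  · refine le_trans ?_ (le_heatKernel hR (by linarith) (by linarith) _)
    refine mul_le_mul_of_nonneg_left ?_ (by positivity)
    rw [Real.exp_le_exp, neg_le_neg_iff, div_le_iff₀ (by positivity)]
    field_simp
    linarith
  · refine le_trans ?_ (hu y s hs)
    refine le_trans ?_ (le_atom hR hs1.le (by linarith) y)
    refine mul_le_mul_of_nonneg_left ?_ (by positivity)
    rw [Real.exp_le_exp, neg_le_neg_iff, div_le_iff₀ (by positivity)]
    linarith

theorem heatOp_atom_le {B : ℝ} (hB : ∀ s, deriv cutoff s ≤ B) (hR : 0 < R) (x : E) {t : ℝ}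
    (ht : t - τ ∈ Icc R (2 * R)) :
    heatOp (atom a c R τ) x t
      ≤ B * (R ^ (-(a / 2 + 1)) * Real.exp (-(‖x - c‖ ^ 2 / (8 * R)))) := by
  have hB0 : 0 ≤ B := (deriv_cutoff_nonneg 0).trans (hB 0)
  rw [heatOp_atom hR]
  calc _ ≤ R ^ (((n : ℝ) - a) / 2) * (B / R) *
        (R ^ (-((n : ℝ) / 2)) * Real.exp (-(‖x - c‖ ^ 2 / (8 * R)))) := by
        refine mul_le_mul ?_ (heatKernel_le hR ht.1 ht.2 _) (heatKernel_nonneg _ _) (by positivity)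
        exact mul_le_mul_of_nonneg_left (div_le_div_of_nonneg_right (hB _) hR.le) (by positivity)
    _ = _ := by
        rw [show -(a / 2 + 1) = (((n : ℝ) - a) / 2 + -((n : ℝ) / 2)) + -1 by ring,
          Real.rpow_add hR, Real.rpow_add hR, Real.rpow_neg_one]
        ring

/-- An atom of scale `R` dominates the source of the next atom, of scale `κ * R`. -/
theorem exists_heatOp_atom_le_heatConv (hn : 1 ≤ n) (a : ℝ) (hα : 0 < α) (hlam : 0 ≤ lam)
    (hσ : 0 ≤ σ) (hκ0 : 0 < κ) (hκ1 : κ ≤ 1 / 4) (hκ : 8 * κ * (α / n + σ / 2) ≤ 1) :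
    ∃ C > 0, ∀ (c : E) (R τ : ℝ), 0 < R → -(2 * R) ≤ τ → ∀ u : E → ℝ → ℝ,
      (∀ x, ∀ t ∈ Ioo (0 : ℝ) 1, atom a c R τ x t ≤ u x t) → ∀ x, ∀ t ∈ Ioo (0 : ℝ) 1,
      ENNReal.ofReal (heatOp (atom a c (κ * R) (τ + 3 * R)) x t)
        ≤ ENNReal.ofReal (C * R ^ ((α + a * (lam + σ) - n - 2) / 2 - (a / 2 + 1)))
          * (heatConv α lam 1 u x t * ENNReal.ofReal (u x t ^ σ)) := by
  obtain ⟨B, hB0, hB⟩ := exists_deriv_cutoff_le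
  set V := (volume (Metric.ball (0 : E) 1)).toReal with hV
  have hV0 : 0 < V := ENNReal.toReal_pos (Metric.measure_ball_pos _ _ one_pos).ne'
    measure_ball_lt_top.ne
  have hn0 : (0 : ℝ) < n := by exact_mod_cast hn
  -- All powers are turned into exponentials, so that the final comparison is a linear identity
  -- between exponents.
  obtain ⟨d, hd⟩ : ∃ d, (20 * Real.pi) ^ (-((n : ℝ) / 2)) = Real.exp d :=
    ⟨_, (Real.exp_log (by positivity)).symm⟩
  obtain ⟨k, rfl⟩ : ∃ k, κ = Real.exp k := ⟨_, (Real.exp_log hκ0).symm⟩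
  refine ⟨2 * B / V * Real.exp ((1 - d) * (α / n) + (1 / 2 - d) * lam - d * σ - (a / 2 + 1) * k),
    by positivity, fun c R τ hR hτ u hu x t ht => ?_⟩
  have hR' : 0 < Real.exp k * R := by positivity
  by_cases hmem : t - (τ + 3 * R) ∈ Icc (Real.exp k * R) (2 * (Real.exp k * R))
  swap
  · rw [heatOp_atom_eq_zero hR' x hmem]
    simp
  have ht1 : τ + 3 * R ≤ t := by have := hmem.1; linarith
  have ht2 : t ≤ τ + 5 * R := by have := hmem.2; nlinarith
  have hK := le_heatConv hα hlam hR hτ hu x ht1 ht2 ht.2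
  have hw := (le_atom hR (by linarith) ht2 x).trans (hu x t ht)
  have hwσ := Real.rpow_le_rpow (by positivity) hw hσ
  refine le_trans ?_ (mul_le_mul_right (mul_le_mul' hK (ENNReal.ofReal_le_ofReal hwσ)) _)
  rw [← ENNReal.ofReal_mul (by positivity), ← ENNReal.ofReal_mul (by positivity)]
  refine ENNReal.ofReal_le_ofReal ((heatOp_atom_le hB hR' x hmem).trans ?_)
  rw [← hV]
  set z := ‖x - c‖ ^ 2
  have hz : 0 ≤ z := sq_nonneg _
  obtain ⟨r, hr⟩ : ∃ r, R = Real.exp r := ⟨_, (Real.exp_log hR).symm⟩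
  -- The smallness of `κ` enters here: the source of scale `κ * R` decays in space at least as fast
  -- as the lower bound for the right-hand side.
  have hzR : z / R * (α / n + σ / 2) ≤ z / (8 * (Real.exp k * R)) := by
    rw [div_mul_eq_mul_div, div_le_div_iff₀ hR (by positivity)]
    nlinarith [mul_nonneg hz hR.le]
  have hpow : ∀ p, R ^ p = Real.exp (r * p) := fun p => by rw [hr, Real.exp_mul]
  have hpow' : ∀ p, (Real.exp k * R) ^ p = Real.exp ((k + r) * p) := fun p => by
    rw [hr, ← Real.exp_add, Real.exp_mul]
  rw [hd, hpow', hpow, hpow, hpow, hpow]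
  simp only [← Real.exp_add, ← Real.exp_mul]
  calc B * Real.exp ((k + r) * -(a / 2 + 1) + -(z / (8 * (Real.exp k * R))))
      ≤ B * Real.exp ((k + r) * -(a / 2 + 1) + -(z / R * (α / n + σ / 2))) := by
        gcongr
    _ = _ := by
        have : R / 2 = Real.exp r / 2 := by rw [hr]
        rw [this]
        have h2 : ∀ e1 e2 e3 e4 e5 : ℝ, 2 * B / V * Real.exp e1 * Real.exp e2 *
            (Real.exp e3 * (V * Real.exp e4 * (Real.exp r / 2)) * Real.exp e5)
            = B * Real.exp (e1 + e2 + e3 + e4 + r + e5) := fun e1 e2 e3 e4 e5 => by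
          simp only [Real.exp_add]
          field_simp
        rw [h2]
        congr 2
        field_simp
        ring

end Choquard

/-! ### Smoothness of the superposition -/

namespace Choquard

variable {n : ℕ}

local notation "E" => EuclideanSpace ℝ (Fin n)

theorem heatOp_heatKernel (x : E) {t : ℝ} (ht : 0 < t) : heatOp heatKernel x t = 0 := by
  simpa using heatOp_mul_heatKernel 0 x (τ := 0) ht (hasDerivAt_const t (1 : ℝ))

/-- Near a point of positive time, the heat kernel can be replaced by a test function. -/
theorem exists_testFunction_eq_heatKernel (x : E) {t : ℝ} (ht : 0 < t) :
    ∃ Ψ : E × ℝ → ℝ, ContDiff ℝ ∞ Ψ ∧ HasCompactSupport Ψ ∧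
      (∀ q ∈ Metric.ball (x, t) (t / 4), Ψ q = heatKernel q.1 q.2) ∧
      ∀ q ∈ Metric.ball (x, t) (t / 4), heatOp (fun x t => Ψ (x, t)) q.1 q.2 = 0 := by
  let η : ContDiffBump (x, t) := ⟨t / 4, t / 2, by linarith, by linarith⟩
  have hpos : ∀ q ∈ Metric.ball (x, t) (t / 2), 0 < q.2 := fun q hq => by
    have h1 : dist q.2 t < t / 2 := lt_of_le_of_lt (le_max_right _ _) (Metric.mem_ball.1 hq)
    have h2 := (abs_lt.1 (by simpa [Real.dist_eq] using h1)).1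
    linarith
  have heq : ∀ q ∈ Metric.ball (x, t) (t / 4), η q * heatKernel q.1 q.2 = heatKernel q.1 q.2 :=
    fun q hq => by
      rw [η.one_of_mem_closedBall (Metric.ball_subset_closedBall hq), one_mul]
  refine ⟨fun q => η q * heatKernel q.1 q.2, ?_, η.hasCompactSupport.mul_right, heq,
    fun q hq => ?_⟩
  · rw [contDiff_iff_contDiffAt]
    rintro q
    by_cases hq : 0 < q.2
    · exact η.contDiff.contDiffAt.mul (contDiffAt_heatKernel q.1 hq)
    · have : (fun q => η q * heatKernel q.1 q.2) =ᶠ[𝓝 q] fun _ => 0 := by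
        have h1 : q ∉ tsupport η := fun h => by
          rw [η.tsupport_eq] at h
          have h1 : dist q.2 t ≤ t / 2 := (le_max_right _ _).trans (Metric.mem_closedBall.1 h)
          have h2 := (abs_le.1 (by simpa [Real.dist_eq] using h1)).1
          linarith
        filter_upwards [notMem_tsupport_iff_eventuallyEq.1 h1] with p hp
        rw [hp]
        simp
      exact contDiffAt_const.congr_of_eventuallyEq this
  · have h1 : (fun q => η q * heatKernel q.1 q.2) =ᶠ[𝓝 (q.1, q.2)]
        fun q => heatKernel q.1 q.2 := by
      filter_upwards [Metric.isOpen_ball.mem_nhds hq] with p hp using heq p hp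
    rw [heatOp_congr h1]
    exact heatOp_heatKernel q.1 (hpos q (Metric.ball_subset_ball (by linarith) hq))

section Superposition

variable {ι : Type*} {a : ℝ} {R τ : ι → ℝ} {c : EuclideanSpace ℝ (Fin n)}

/-- Near a point of positive time all but finitely many atoms are fully switched on, with poles
close to `(c, 0)`. They are then translates of a single test function `Ψ` that agrees with the heat
kernel near `(x - c, t)`. The two errors of `t / 8` fit into the ball of radius `t / 4`. -/
theorem exists_finset_atom_eq (hR : ∀ i, 0 < R i)
    (hfin : ∀ ε > 0, {i | ¬ (|τ i| < ε ∧ τ i + 2 * R i < ε)}.Finite) (x : E) {t : ℝ} (ht : 0 < t) :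
    ∃ (s : Finset ι) (Ψ : E × ℝ → ℝ), ContDiff ℝ ∞ Ψ ∧ HasCompactSupport Ψ ∧
      (∀ p ∈ Metric.ball (x, t) (t / 8), ∀ i, i ∉ s →
        atom a c (R i) (τ i) p.1 p.2 = R i ^ (((n : ℝ) - a) / 2) * Ψ (p - (c, τ i))) ∧
      ∀ i, i ∉ s → heatOp (fun x t => Ψ (x, t)) (x - c) (t - τ i) = 0 := by
  obtain ⟨Ψ, h1, h2, h3, h4⟩ := exists_testFunction_eq_heatKernel (x - c) ht
  have hf := hfin (t / 8) (by positivity)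
  have hball : ∀ p ∈ Metric.ball (x, t) (t / 8), ∀ i, |τ i| < t / 8 →
      p - (c, τ i) ∈ Metric.ball (x - c, t) (t / 4) := fun p hp i hi => by
    rw [mem_ball_iff_norm] at hp ⊢
    have : p - (c, τ i) - (x - c, t) = (p - (x, t)) - (0, τ i) := by
      ext1
      · simp
      · simp only [Prod.snd_sub]
        ring
    rw [this]
    refine lt_of_le_of_lt (norm_sub_le _ _) ?_
    have h0 : ‖((0 : E), τ i)‖ = |τ i| := by simp [Prod.norm_def]
    rw [h0]
    linarith
  have hs : ∀ i, i ∉ hf.toFinset → |τ i| < t / 8 ∧ τ i + 2 * R i < t / 8 := fun i hi => by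
    simpa using hi
  refine ⟨hf.toFinset, Ψ, h1, h2, fun p hp i hi => ?_, fun i hi => ?_⟩
  · obtain ⟨hi1, hi2⟩ := hs i hi
    have hb := hball p hp i hi1
    have h5 : dist p.2 t < t / 8 := lt_of_le_of_lt (le_max_right _ _) (Metric.mem_ball.1 hp)
    have h6 := (abs_lt.1 (by simpa [Real.dist_eq] using h5)).1
    rw [h3 _ hb, atom_eq (hR i) p.1 (by linarith)]
    rfl
  · exact h4 _ (hball (x, t) (Metric.mem_ball_self (by positivity)) i (hs i hi).1)

/-- The tail `G` is a summable superposition of translates of `Ψ`, hence smooth, and caloric at `(x,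
t)`; the rest is a finite sum. -/
theorem exists_eventuallyEq_tsum_atom (hR : ∀ i, 0 < R i)
    (hsum : Summable fun i => R i ^ (((n : ℝ) - a) / 2))
    (hfin : ∀ ε > 0, {i | ¬ (|τ i| < ε ∧ τ i + 2 * R i < ε)}.Finite) (x : E) {t : ℝ} (ht : 0 < t) :
    ∃ (s : Finset ι) (G : E × ℝ → ℝ), ContDiff ℝ ∞ G ∧ heatOp (fun x t => G (x, t)) x t = 0 ∧
      (Summable fun i => atom a c (R i) (τ i) x t) ∧
      (fun p : E × ℝ => ∑' i, atom a c (R i) (τ i) p.1 p.2) =ᶠ[𝓝 (x, t)]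
        fun p => ∑ i ∈ s, atom a c (R i) (τ i) p.1 p.2 + G p := by
  obtain ⟨s, Ψ, h1, h2, h3, h4⟩ := exists_finset_atom_eq (a := a) (c := c) hR hfin x ht
  have hm : Summable fun i : {i // i ∉ s} => |R i ^ (((n : ℝ) - a) / 2)| :=
    (hsum.abs).subtype _
  have hsm : ∀ p ∈ Metric.ball (x, t) (t / 8), Summable fun i => atom a c (R i) (τ i) p.1 p.2 :=
    fun p hp => by
      rw [← s.summable_compl_iff]
      refine (summable_translate h1.continuous h2 hm (fun i => (c, τ i)) p).congr fun i => ?_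
      exact (h3 p hp i i.2).symm
  refine ⟨s, fun p => ∑' i : {i // i ∉ s}, R i ^ (((n : ℝ) - a) / 2) * Ψ (p - (c, τ i)),
    contDiff_tsum_translate h1 h2 hm _, ?_,
    hsm (x, t) (Metric.mem_ball_self (by positivity)), ?_⟩
  · exact heatOp_tsum_translate_eq_zero h1 h2 hm (fun i => (c, τ i)) x t fun i => h4 i i.2
  · filter_upwards [Metric.ball_mem_nhds (x, t) (by positivity : 0 < t / 8)] with p hp
    rw [← (hsm p hp).sum_add_tsum_subtype_compl s]
    congr 1
    exact tsum_congr fun i => h3 p hp i i.2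

theorem summable_atom (hR : ∀ i, 0 < R i)
    (hsum : Summable fun i => R i ^ (((n : ℝ) - a) / 2))
    (hfin : ∀ ε > 0, {i | ¬ (|τ i| < ε ∧ τ i + 2 * R i < ε)}.Finite) (x : E) {t : ℝ} (ht : 0 < t) :
    Summable fun i => atom a c (R i) (τ i) x t := by
  obtain ⟨-, -, -, -, h, -⟩ := exists_eventuallyEq_tsum_atom (c := c) hR hsum hfin x ht
  exact h

theorem contDiffAt_tsum_atom (hR : ∀ i, 0 < R i)
    (hsum : Summable fun i => R i ^ (((n : ℝ) - a) / 2))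
    (hfin : ∀ ε > 0, {i | ¬ (|τ i| < ε ∧ τ i + 2 * R i < ε)}.Finite) (x : E) {t : ℝ} (ht : 0 < t) :
    ContDiffAt ℝ ∞ (fun p : E × ℝ => ∑' i, atom a c (R i) (τ i) p.1 p.2) (x, t) := by
  obtain ⟨s, G, hG, -, -, h⟩ := exists_eventuallyEq_tsum_atom (c := c) hR hsum hfin x ht
  refine ContDiffAt.congr_of_eventuallyEq (ContDiffAt.add ?_ hG.contDiffAt) h
  exact ContDiffAt.sum fun i _ => (contDiff_atom (hR i)).contDiffAt

theorem exists_heatOp_tsum_atom_eq (hR : ∀ i, 0 < R i)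
    (hsum : Summable fun i => R i ^ (((n : ℝ) - a) / 2))
    (hfin : ∀ ε > 0, {i | ¬ (|τ i| < ε ∧ τ i + 2 * R i < ε)}.Finite) (x : E) {t : ℝ} (ht : 0 < t) :
    ∃ s : Finset ι, heatOp (fun x t => ∑' i, atom a c (R i) (τ i) x t) x t
      = ∑ i ∈ s, heatOp (atom a c (R i) (τ i)) x t := by
  obtain ⟨s, G, hG, hG0, -, h⟩ := exists_eventuallyEq_tsum_atom (c := c) hR hsum hfin x ht
  have hc : ∀ i, ContDiffAt ℝ 2 (fun p : E × ℝ => atom a c (R i) (τ i) p.1 p.2) (x, t) := fun i =>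
    ((contDiff_atom (hR i)).of_le two_le_infty).contDiffAt
  refine ⟨s, ?_⟩
  have h1 := heatOp_congr h
  have h2 := heatOp_add (F := fun p : E × ℝ => ∑ i ∈ s, atom a c (R i) (τ i) p.1 p.2) (G := G)
    (x := x) (t := t) (ContDiffAt.sum fun i _ => hc i)
    ((hG.of_le two_le_infty).contDiffAt)
  have h3 := heatOp_sum s (F := fun i (p : E × ℝ) => atom a c (R i) (τ i) p.1 p.2)
    (x := x) (t := t) fun i _ => hc i
  refine h1.trans (h2.trans ?_)
  rw [hG0, add_zero]
  exact h3

end Superposition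

end Choquard

/-! ### Integrability of the superposition -/

namespace Choquard

/-- Write `w = w ^ (1/2) * w ^ (1/2)`, bound one factor times `h` by its supremum, and bound the
`p`-th power of the supremum by a sum. No convexity is needed, so exponents below `1` are included.
-/
theorem tsum_mul_rpow_le {ι : Type*} (w h : ι → ℝ≥0∞) {p : ℝ} (hp : 0 < p) :
    (∑' i, w i * h i) ^ p
      ≤ (∑' i, w i ^ (1 / 2 : ℝ)) ^ p * ∑' i, w i ^ (p / 2) * h i ^ p := by
  set M := ⨆ i, w i ^ (1 / 2 : ℝ) * h i
  have h1 : ∑' i, w i * h i ≤ (∑' i, w i ^ (1 / 2 : ℝ)) * M := by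
    rw [← ENNReal.tsum_mul_right]
    refine ENNReal.tsum_le_tsum fun i => ?_
    have : w i = w i ^ (1 / 2 : ℝ) * w i ^ (1 / 2 : ℝ) := by
      rw [← ENNReal.rpow_add_of_nonneg _ _ (by norm_num) (by norm_num)]
      norm_num
    calc w i * h i = w i ^ (1 / 2 : ℝ) * (w i ^ (1 / 2 : ℝ) * h i) := by
          rw [← mul_assoc, ← this]
      _ ≤ _ := mul_le_mul_right (le_iSup (fun i => w i ^ (1 / 2 : ℝ) * h i) i) _
  have h2 : M ^ p ≤ ∑' i, w i ^ (p / 2) * h i ^ p := by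
    rw [← ENNReal.le_rpow_inv_iff hp]
    refine iSup_le fun i => ?_
    rw [ENNReal.le_rpow_inv_iff hp, ENNReal.mul_rpow_of_nonneg _ _ hp.le,
      ← ENNReal.rpow_mul, show 1 / 2 * p = p / 2 by ring]
    exact ENNReal.le_tsum (f := fun i => w i ^ (p / 2) * h i ^ p) i
  calc _ ≤ ((∑' i, w i ^ (1 / 2 : ℝ)) * M) ^ p := ENNReal.rpow_le_rpow h1 hp.le
    _ = (∑' i, w i ^ (1 / 2 : ℝ)) ^ p * M ^ p := ENNReal.mul_rpow_of_nonneg _ _ hp.le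
    _ ≤ _ := mul_le_mul_right h2 _

variable {n : ℕ}

local notation "E" => EuclideanSpace ℝ (Fin n)

/-- The kernel `t ^ (-b / 2) * exp (-|x|² / (4 t))`, extended by `0` to `t ≤ 0`. -/
noncomputable def gaussianProfile (b : ℝ) (p : EuclideanSpace ℝ (Fin n) × ℝ) : ℝ :=
  if 0 < p.2 then p.2 ^ (-(b / 2)) * Real.exp (-(‖p.1‖ ^ 2 / (4 * p.2))) else 0

theorem measurable_gaussianProfile (b : ℝ) : Measurable (gaussianProfile (n := n) b) := by
  refine Measurable.ite (measurableSet_lt measurable_const measurable_snd) ?_ measurable_const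
  fun_prop

theorem gaussianProfile_nonneg (b : ℝ) (p : E × ℝ) : 0 ≤ gaussianProfile b p := by
  unfold gaussianProfile
  split_ifs
  · positivity
  · exact le_rfl

theorem lintegral_exp_neg_mul_norm_sq {β : ℝ} (hβ : 0 < β) :
    ∫⁻ x : E, ENNReal.ofReal (Real.exp (-β * ‖x‖ ^ 2))
      = ENNReal.ofReal ((Real.pi / β) ^ ((n : ℝ) / 2)) := by
  have h := GaussianFourier.integral_rexp_neg_mul_sq_norm (V := E) hβ
  rw [finrank_euclideanSpace, Fintype.card_fin] at h
  have hi : Integrable fun x : E => Real.exp (-β * ‖x‖ ^ 2) := by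
    by_contra hc
    rw [integral_undef hc] at h
    exact (by positivity : (0 : ℝ) < (Real.pi / β) ^ ((n : ℝ) / 2)).ne h
  rw [← ofReal_integral_eq_lintegral_ofReal hi (Eventually.of_forall fun x => (Real.exp_pos _).le),
    h]

/-- Integrating out space leaves a multiple of `s ^ ((n - b * p) / 2)`, integrable at `0` because
the exponent exceeds `-1`. -/
theorem lintegral_gaussianProfile_lt_top {b p T : ℝ} (hp : 0 < p) (hb : b * p < n + 2) :
    ∫⁻ q in slab (univ : Set E) T, ENNReal.ofReal (gaussianProfile b q) ^ p < ⊤ := by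
  have hm : Measurable fun q : E × ℝ => ENNReal.ofReal (gaussianProfile b q) ^ p :=
    (measurable_gaussianProfile b).ennreal_ofReal.pow_const p
  rw [slab, Measure.volume_eq_prod, ← Measure.prod_restrict, Measure.restrict_univ,
    lintegral_prod_symm _ hm.aemeasurable]
  have h1 : ∀ s ∈ Ioo 0 T, ∫⁻ x : E, ENNReal.ofReal (gaussianProfile b (x, s)) ^ p
      = ENNReal.ofReal ((4 * Real.pi / p) ^ ((n : ℝ) / 2) * s ^ ((n - b * p) / 2)) := by
    intro s hs
    have hs0 : 0 < s := hs.1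
    have h2 : ∀ x : E, ENNReal.ofReal (gaussianProfile b (x, s)) ^ p
        = ENNReal.ofReal (s ^ (-(b * p / 2)))
          * ENNReal.ofReal (Real.exp (-(p / (4 * s)) * ‖x‖ ^ 2)) := fun x => by
      rw [ENNReal.ofReal_rpow_of_nonneg (gaussianProfile_nonneg _ _) hp.le, gaussianProfile,
        if_pos hs0, Real.mul_rpow (by positivity) (by positivity), ← Real.rpow_mul hs0.le,
        ← Real.exp_mul, ENNReal.ofReal_mul (by positivity)]
      congr 3
      · ring
      · ring
    simp_rw [h2]
    rw [lintegral_const_mul _ (by fun_prop), lintegral_exp_neg_mul_norm_sq (by positivity),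
      ← ENNReal.ofReal_mul (by positivity)]
    congr 1
    rw [show Real.pi / (p / (4 * s)) = 4 * Real.pi / p * s by field_simp,
      Real.mul_rpow (by positivity) hs0.le, mul_left_comm, ← Real.rpow_add hs0]
    congr 2
    ring
  rw [setLIntegral_congr_fun measurableSet_Ioo h1]
  rcases le_or_gt T 0 with hT | hT
  · simp [Ioo_eq_empty_of_le hT]
  have h3 : IntegrableOn (fun s : ℝ => s ^ (((n : ℝ) - b * p) / 2)) (Ioo 0 T) :=
    (intervalIntegral.integrableOn_Ioo_rpow_iff hT).2 (by linarith)
  exact (h3.const_mul _).lintegral_lt_top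

theorem lintegral_gaussianProfile_translate_le {b p : ℝ} (hp : 0 < p) (c : E) {τ : ℝ}
    (hτ : -2 ≤ τ) :
    ∫⁻ q in slab (univ : Set E) 1, ENNReal.ofReal (gaussianProfile b (q - (c, τ))) ^ p
      ≤ ∫⁻ q in slab (univ : Set E) 3, ENNReal.ofReal (gaussianProfile b q) ^ p := by
  have hS : ∀ T, MeasurableSet (slab (univ : Set E) T) := fun T =>
    MeasurableSet.univ.prod measurableSet_Ioo
  have : (volume : Measure (E × ℝ)).IsAddRightInvariant := by
    rw [Measure.volume_eq_prod]
    infer_instance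
  rw [← lintegral_indicator (hS 3), ← lintegral_indicator (hS 1)]
  refine le_trans (lintegral_mono fun q => ?_) (lintegral_sub_right_eq_self
    ((slab (univ : Set E) 3).indicator fun q => ENNReal.ofReal (gaussianProfile b q) ^ p)
    (c, τ)).le
  by_cases hq : q ∈ slab (univ : Set E) 1
  · rw [indicator_of_mem hq]
    by_cases hq0 : 0 < q.2 - τ
    · rw [indicator_of_mem]
      refine ⟨mem_univ _, hq0, ?_⟩
      have := hq.2.2
      simp only [Prod.snd_sub]
      linarith
    · have : gaussianProfile b (q - (c, τ)) = 0 := if_neg hq0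
      rw [this]
      simp [hp]
  · rw [indicator_of_notMem hq]
    exact zero_le

/-- The atom vanishes before age `R`, so `R ^ ((n - b) / 2)` may be replaced by the same power of
the age. This trades singularity of the kernel for a positive power of `R` when `b > a`. -/
theorem atom_le_gaussianProfile {a b R τ : ℝ} (hR : 0 < R) (hbn : b ≤ n) (c : E) (q : E × ℝ) :
    atom a c R τ q.1 q.2 ≤ R ^ ((b - a) / 2) * gaussianProfile b (q - (c, τ)) := by
  rcases le_or_gt q.2 (τ + R) with h | h
  · rw [atom_eq_zero hR _ h]
    exact mul_nonneg (by positivity) (gaussianProfile_nonneg _ _)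
  · have hs : 0 < q.2 - τ := by linarith
    refine (atom_le hR _ _).trans ?_
    rw [heatKernel_of_pos _ hs, gaussianProfile]
    simp only [Prod.snd_sub, Prod.fst_sub, if_pos hs]
    rw [← mul_assoc, ← mul_assoc]
    refine mul_le_mul_of_nonneg_right ?_ (Real.exp_pos _).le
    rw [one_div, ← Real.rpow_neg (by positivity)]
    calc R ^ (((n : ℝ) - a) / 2) * (4 * Real.pi * (q.2 - τ)) ^ (-((n : ℝ) / 2))
        ≤ R ^ (((n : ℝ) - a) / 2) * (q.2 - τ) ^ (-((n : ℝ) / 2)) := by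
          refine mul_le_mul_of_nonneg_left ?_ (by positivity)
          refine Real.rpow_le_rpow_of_nonpos hs ?_ (by simp; positivity)
          nlinarith [Real.pi_gt_three]
      _ = R ^ ((b - a) / 2) * (R ^ (((n : ℝ) - b) / 2) * (q.2 - τ) ^ (-((n : ℝ) / 2))) := by
          rw [← mul_assoc, ← Real.rpow_add hR]
          congr 2
          ring
      _ ≤ R ^ ((b - a) / 2) * ((q.2 - τ) ^ (((n : ℝ) - b) / 2)
            * (q.2 - τ) ^ (-((n : ℝ) / 2))) := by
          gcongr
          linarith
      _ = _ := by
          rw [← Real.rpow_add hs]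
          congr 2
          ring

theorem lintegral_tsum_atom_lt_top {ι : Type*} [Countable ι] {a p : ℝ} {R τ : ι → ℝ} (c : E)
    (hp : 0 < p) (han : a < n) (hap : a * p < n + 2) (hR : ∀ i, 0 < R i)
    (hsum : ∀ r : ℝ, 0 < r → Summable fun i => R i ^ r) (hτ : ∀ i, -2 ≤ τ i) :
    ∫⁻ q in slab (univ : Set E) 1,
      (∑' i, ENNReal.ofReal (atom a c (R i) (τ i) q.1 q.2)) ^ p < ⊤ := by
  -- The strict inequalities on `a` leave room for `b > a`: the profile is still integrable, and the
  -- weights `R ^ ((b - a) / 2)` are summable.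
  obtain ⟨b, hab, hbn, hbp⟩ : ∃ b, a < b ∧ b ≤ n ∧ b * p < n + 2 := by
    have hlt : a < ((n : ℝ) + 2) / p := (lt_div_iff₀ hp).2 hap
    obtain ⟨b, hb1, hb2⟩ := exists_between (lt_min han hlt)
    exact ⟨b, hb1, (hb2.trans_le (min_le_left _ _)).le,
      (lt_div_iff₀ hp).1 (hb2.trans_le (min_le_right _ _))⟩
  set w : ι → ℝ≥0∞ := fun i => ENNReal.ofReal (R i ^ ((b - a) / 2))
  have hw : ∀ r : ℝ, 0 < r → ∑' i, w i ^ r < ⊤ := fun r hr => by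
    have h1 : ∀ i, w i ^ r = ENNReal.ofReal (R i ^ ((b - a) / 2 * r)) := fun i => by
      rw [ENNReal.ofReal_rpow_of_nonneg (Real.rpow_nonneg (hR i).le _) hr.le,
        ← Real.rpow_mul (hR i).le]
    simp_rw [h1]
    rw [← ENNReal.ofReal_tsum_of_nonneg (fun i => Real.rpow_nonneg (hR i).le _)
      (hsum _ (mul_pos (by linarith) hr))]
    exact ENNReal.ofReal_lt_top
  set G := ∫⁻ q in slab (univ : Set E) 3, ENNReal.ofReal (gaussianProfile b q) ^ p
  have hG : G < ⊤ := lintegral_gaussianProfile_lt_top hp hbp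
  have hm : ∀ i, Measurable fun q : E × ℝ =>
      w i ^ (p / 2) * ENNReal.ofReal (gaussianProfile b (q - (c, τ i))) ^ p := fun i =>
    (((measurable_gaussianProfile b).comp
      (measurable_id.sub measurable_const)).ennreal_ofReal.pow_const p).const_mul _
  calc _ ≤ ∫⁻ q in slab (univ : Set E) 1, (∑' i, w i ^ (1 / 2 : ℝ)) ^ p
        * ∑' i, w i ^ (p / 2) * ENNReal.ofReal (gaussianProfile b (q - (c, τ i))) ^ p := by
        refine lintegral_mono fun q => ?_
        refine le_trans (ENNReal.rpow_le_rpow (ENNReal.tsum_le_tsum fun i => ?_) hp.le)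
          (tsum_mul_rpow_le w
            (fun i => ENNReal.ofReal (gaussianProfile b (q - (c, τ i)))) hp)
        rw [← ENNReal.ofReal_mul (Real.rpow_nonneg (hR i).le _)]
        exact ENNReal.ofReal_le_ofReal (atom_le_gaussianProfile (hR i) hbn c q)
    _ = (∑' i, w i ^ (1 / 2 : ℝ)) ^ p * ∑' i, w i ^ (p / 2) *
        ∫⁻ q in slab (univ : Set E) 1,
          ENNReal.ofReal (gaussianProfile b (q - (c, τ i))) ^ p := by
        rw [lintegral_const_mul _ (Measurable.tsum hm),
          lintegral_tsum fun i => (hm i).aemeasurable]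
        congr 1
        refine tsum_congr fun i => lintegral_const_mul _ ?_
        exact ((measurable_gaussianProfile b).comp
          (measurable_id.sub measurable_const)).ennreal_ofReal.pow_const p
    _ ≤ (∑' i, w i ^ (1 / 2 : ℝ)) ^ p * ∑' i, w i ^ (p / 2) * G := by
        gcongr with i
        exact lintegral_gaussianProfile_translate_le hp c (hτ i)
    _ < ⊤ := by
        rw [ENNReal.tsum_mul_right]
        exact ENNReal.mul_lt_top (ENNReal.rpow_lt_top_of_nonneg hp.le (hw _ (by norm_num)).ne)
          (ENNReal.mul_lt_top (hw _ (by positivity)) hG)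

end Choquard

/-! ### Choice of the rate, and a criterion for solutions -/

namespace Choquard

theorem bigG_nonneg {n : ℕ} (hn : 1 ≤ n) {α lam : ℝ} (hα : α < (n : ℝ) + 2) :
    0 ≤ bigG n α lam := by
  have hn0 : (0 : ℝ) < n := by exact_mod_cast hn
  unfold bigG
  split_ifs with h
  · have : (2 * ((n : ℝ) + 2) - α) / n - (n + 2) / n = (n + 2 - α) / n := by ring
    have h2 : 0 ≤ ((n : ℝ) + 2 - α) / n := div_nonneg (by linarith) hn0.le
    linarith
  · exact le_max_left _ _

/-- The blow-up rate `R ^ (-a / 2)` at scale `R` admitted by the exponents. -/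
theorem exists_rate {n : ℕ} (hn : 1 ≤ n) {α lam σ : ℝ} (hlam : 0 < lam)
    (hσ : bigG n α lam < σ) :
    ∃ a : ℝ, 0 < a ∧ a < n ∧ a * lam < n + 2 ∧ n + 4 - α < a * (lam + σ - 1) := by
  have hn0 : (0 : ℝ) < n := by exact_mod_cast hn
  -- The extremal rate is `min n ((n + 2) / lam)`, which explains the two branches of `bigG`.
  -- Lowering it slightly makes its upper bounds strict and keeps the last inequality.
  obtain ⟨a₀, h0, h1, h2, h3⟩ : ∃ a₀ : ℝ, 0 < a₀ ∧ a₀ ≤ n ∧ a₀ * lam ≤ n + 2 ∧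
      n + 4 - α < a₀ * (lam + σ - 1) := by
    unfold bigG at hσ
    split_ifs at hσ with h
    · refine ⟨n, hn0, le_rfl, ?_, ?_⟩
      · have := (lt_div_iff₀ hn0).1 h
        linarith
      · rw [sub_lt_iff_lt_add, div_lt_iff₀ hn0] at hσ
        linarith
    · rw [not_lt, div_le_iff₀ hn0] at h
      have h4 := (le_max_right _ _).trans_lt hσ
      refine ⟨((n : ℝ) + 2) / lam, by positivity, ?_, ?_, ?_⟩
      · rw [div_le_iff₀ hlam]
        linarith
      · rw [div_mul_cancel₀ _ hlam.ne']
      · have h5 : ((n : ℝ) + 2) / lam * (lam + (1 - (α - 2) / ((n : ℝ) + 2) * lam) - 1)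
            = n + 4 - α := by
          field_simp
          ring
        rw [← h5]
        exact mul_lt_mul_of_pos_left (by linarith) (by positivity)
  have hc : ContinuousAt (fun a : ℝ => a * (lam + σ - 1)) a₀ := by fun_prop
  have hev : ∀ᶠ a in 𝓝[<] a₀, n + 4 - α < a * (lam + σ - 1) ∧ 0 < a ∧ a < a₀ :=
    (((hc.eventually (lt_mem_nhds h3)).and (lt_mem_nhds h0)).filter_mono
      nhdsWithin_le_nhds |>.and self_mem_nhdsWithin).mono fun a ha => ⟨ha.1.1, ha.1.2, ha.2⟩
  obtain ⟨a, ha1, ha2, ha3⟩ := hev.exists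
  exact ⟨a, ha2, ha3.trans_le h1, (mul_lt_mul_of_pos_right ha3 hlam).trans_le h2, ha1⟩

variable {n : ℕ}

local notation "E" => EuclideanSpace ℝ (Fin n)

/-- The sum dominates every atom, so each source is charged against the full nonlinearity, of which
it uses only a fraction `θ i`. The fractions total at most `1`. -/
theorem isPosSmoothSolution_tsum_atom {ι : Type*} [Countable ι] {a α lam σ : ℝ} {R τ θ : ι → ℝ}
    (c : E) (hlam : 0 < lam) (han : a < n) (hap : a * lam < n + 2) (hR : ∀ i, 0 < R i)
    (hsum : ∀ r : ℝ, 0 < r → Summable fun i => R i ^ r) (hτ : ∀ i, -2 ≤ τ i)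
    (hfin : ∀ ε > 0, {i | ¬ (|τ i| < ε ∧ τ i + 2 * R i < ε)}.Finite)
    (hpos : ∃ i, τ i + 2 * R i ≤ 0) (hθ0 : ∀ i, 0 ≤ θ i) (hθ : ∀ s : Finset ι, ∑ i ∈ s, θ i ≤ 1)
    (hstep : ∀ i, ∀ u : E → ℝ → ℝ,
      (∀ i, ∀ x, ∀ t ∈ Ioo (0 : ℝ) 1, atom a c (R i) (τ i) x t ≤ u x t) → ∀ x,
      ∀ t ∈ Ioo (0 : ℝ) 1, ENNReal.ofReal (heatOp (atom a c (R i) (τ i)) x t)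
        ≤ ENNReal.ofReal (θ i) * (heatConv α lam 1 u x t * ENNReal.ofReal (u x t ^ σ))) :
    IsPosSmoothSolution α lam σ univ 1 (fun x t => ∑' i, atom a c (R i) (τ i) x t) := by
  have hsum1 := hsum (((n : ℝ) - a) / 2) (by linarith)
  have hS : ∀ x : E, ∀ t ∈ Ioo (0 : ℝ) 1, Summable fun i => atom a c (R i) (τ i) x t :=
    fun x t ht => summable_atom hR hsum1 hfin x ht.1
  have hle : ∀ i, ∀ x : E, ∀ t ∈ Ioo (0 : ℝ) 1,
      atom a c (R i) (τ i) x t ≤ ∑' i, atom a c (R i) (τ i) x t := fun i x t ht =>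
    (hS x t ht).le_tsum i fun j _ => atom_nonneg (hR j) x t
  have hsmooth : ContDiffOn ℝ ∞ (fun p : E × ℝ => ∑' i, atom a c (R i) (τ i) p.1 p.2)
      (slab univ 1) := fun p hp =>
    (contDiffAt_tsum_atom hR hsum1 hfin p.1 hp.2.1).contDiffWithinAt
  have hslab : MeasurableSet (slab (univ : Set E) 1) := MeasurableSet.univ.prod measurableSet_Ioo
  refine ⟨hsmooth, fun x t ht => ?_, ⟨?_, ?_⟩, fun x _ t ht => ?_, fun x _ t ht => ?_⟩
  · obtain ⟨i, hi⟩ := hpos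
    refine lt_of_lt_of_le ?_ (hle i x t ht)
    rw [atom_eq (hR i) x (by linarith [ht.1])]
    exact mul_pos (Real.rpow_pos_of_pos (hR i) _)
      (heatKernel_pos _ (by linarith [ht.1, hR i]))
  · exact hsmooth.continuousOn.aestronglyMeasurable hslab
  · rw [eLpNorm_lt_top_iff_lintegral_rpow_enorm_lt_top (by simpa using hlam)
      ENNReal.ofReal_ne_top, ENNReal.toReal_ofReal hlam.le]
    refine lt_of_le_of_lt (setLIntegral_mono' hslab fun q hq => ?_)
      (lintegral_tsum_atom_lt_top c hlam han hap hR hsum hτ)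
    rw [Real.enorm_eq_ofReal (tsum_nonneg fun i => atom_nonneg (hR i) _ _),
      ENNReal.ofReal_tsum_of_nonneg (fun i => atom_nonneg (hR i) _ _) (hS _ _ hq.2)]
  · obtain ⟨s, hs⟩ := exists_heatOp_tsum_atom_eq (c := c) hR hsum1 hfin x ht.1
    rw [hs]
    exact Finset.sum_nonneg fun i _ => heatOp_atom_nonneg (hR i) x t
  · obtain ⟨s, hs⟩ := exists_heatOp_tsum_atom_eq (c := c) hR hsum1 hfin x ht.1
    rw [hs, ENNReal.ofReal_sum_of_nonneg fun i _ => heatOp_atom_nonneg (hR i) x t]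
    refine (Finset.sum_le_sum fun i _ => hstep i _ hle x t ht).trans ?_
    rw [← Finset.sum_mul, ← ENNReal.ofReal_sum_of_nonneg fun i _ => hθ0 i]
    refine mul_le_of_le_one_left zero_le ?_
    exact ENNReal.ofReal_le_one.2 (hθ s)

/-- The normalized times at which the atoms of a chain with scales `κ ^ k` have their poles. -/
noncomputable def poleTime (κ : ℝ) : ℕ → ℝ
  | 0 => -2
  | k + 1 => poleTime κ k + 3 * κ ^ k

/-! ### Times and scales of the chains -/

section PoleTime

variable {κ : ℝ}

theorem neg_two_mul_pow_le_poleTime (hκ : 0 < κ) (k : ℕ) : -(2 * κ ^ k) ≤ poleTime κ k := by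
  induction k with
  | zero => simp [poleTime]
  | succ k ih =>
    have h1 : 0 < κ ^ k := by positivity
    have h2 : 0 < κ ^ (k + 1) := by positivity
    rw [poleTime]
    linarith

theorem neg_two_le_poleTime (hκ : 0 < κ) (k : ℕ) : -2 ≤ poleTime κ k := by
  induction k with
  | zero => simp [poleTime]
  | succ k ih =>
    have h1 : 0 < κ ^ k := by positivity
    rw [poleTime]
    linarith

theorem one_le_poleTime_succ (hκ : 0 < κ) (k : ℕ) : 1 ≤ poleTime κ (k + 1) := by
  induction k with
  | zero => norm_num [poleTime]
  | succ k ih =>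
    have h1 : 0 < κ ^ (k + 1) := by positivity
    rw [poleTime]
    linarith

/-- The correction `4 * κ ^ k` makes the induction close, since `κ ≤ 1 / 4`. It also leaves room for
the switching time `2 * κ ^ k` below the bound `2`. -/
theorem poleTime_le (hκ : 0 < κ) (hκ1 : κ ≤ 1 / 4) (k : ℕ) : poleTime κ k ≤ 2 - 4 * κ ^ k := by
  induction k with
  | zero => norm_num [poleTime]
  | succ k ih =>
    have h1 : 0 < κ ^ k := by positivity
    rw [poleTime, pow_succ]
    nlinarith

end PoleTime

theorem summable_scale {κ : ℝ} (hκ : 0 < κ) (hκ1 : κ < 1) {ρ : ℝ} (hρ : 0 < ρ) {r : ℝ}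
    (hr : 0 < r) : Summable fun p : ℕ × ℕ => (ρ * κ ^ (p.1 + p.2)) ^ r := by
  have h1 : Summable fun k : ℕ => (κ ^ r) ^ k :=
    summable_geometric_of_lt_one (by positivity) (Real.rpow_lt_one hκ.le hκ1 hr)
  have h2 := h1.mul_of_nonneg h1 (fun _ => by positivity) fun _ => by positivity
  refine (h2.mul_left (ρ ^ r)).congr fun p => ?_
  rw [Real.mul_rpow hρ.le (by positivity), ← Real.rpow_natCast κ, ← Real.rpow_mul hκ.le,
    mul_comm ((p.1 + p.2 : ℕ) : ℝ), Real.rpow_mul hκ.le, Real.rpow_natCast, pow_add]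

theorem exists_scale_tsum_le {κ : ℝ} (hκ : 0 < κ) {C r : ℝ} (hr : 0 < r) :
    ∃ ρ, 0 < ρ ∧ ρ ≤ 1 / 8 ∧ C * ∑' p : ℕ × ℕ, (ρ * κ ^ (p.1 + p.2)) ^ r ≤ 1 := by
  have h1 : ∀ ρ, 0 < ρ → C * ∑' p : ℕ × ℕ, (ρ * κ ^ (p.1 + p.2)) ^ r
      = (C * ∑' p : ℕ × ℕ, (κ ^ (p.1 + p.2)) ^ r) * ρ ^ r := fun ρ hρ => by
    rw [mul_assoc, ← tsum_mul_right]
    congr 1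
    refine tsum_congr fun p => ?_
    rw [Real.mul_rpow hρ.le (by positivity), mul_comm]
  set S := C * ∑' p : ℕ × ℕ, (κ ^ (p.1 + p.2)) ^ r
  have hc : ContinuousAt (fun ρ : ℝ => S * ρ ^ r) 0 :=
    continuousAt_const.mul (Real.continuousAt_rpow_const _ _ (Or.inr hr.le))
  have h2 : ∀ᶠ ρ in 𝓝 (0 : ℝ), S * ρ ^ r < 1 :=
    hc.eventually (gt_mem_nhds (by simp [Real.zero_rpow hr.ne']))
  have h3 : ∀ᶠ ρ in 𝓝[>] (0 : ℝ), S * ρ ^ r < 1 ∧ ρ < 1 / 8 ∧ 0 < ρ :=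
    ((h2.and (gt_mem_nhds (by norm_num : (0 : ℝ) < 1 / 8))).filter_mono
      nhdsWithin_le_nhds |>.and self_mem_nhdsWithin).mono fun a ha => ⟨ha.1.1, ha.1.2, ha.2⟩
  obtain ⟨ρ, h4, h5, h6⟩ := h3.exists
  exact ⟨ρ, h6, h5.le, by rw [h1 ρ h6]; exact h4.le⟩

theorem exists_chain_length {κ a : ℝ} (hκ : 0 < κ) (hκ1 : κ < 1) (ha : 0 < a) {ρ D : ℝ}
    (hρ : 0 < ρ) (hD : 0 < D) (M : ℝ) : ∃ N : ℕ, M ≤ D * (ρ * κ ^ (N + 1)) ^ (-(a / 2)) := by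
  have hb : 1 < κ ^ (-(a / 2)) :=
    Real.one_lt_rpow_of_pos_of_lt_one_of_neg hκ hκ1 (by linarith)
  obtain ⟨N, hN⟩ := pow_unbounded_of_one_lt (M / (D * ρ ^ (-(a / 2)))) hb
  refine ⟨N, ?_⟩
  have hN' : M / (D * ρ ^ (-(a / 2))) ≤ (κ ^ (-(a / 2))) ^ (N + 1) :=
    hN.le.trans (pow_le_pow_right₀ hb.le (Nat.le_succ N))
  rw [div_le_iff₀ (by positivity)] at hN'
  refine hN'.trans (le_of_eq ?_)
  rw [Real.mul_rpow hρ.le (by positivity), ← Real.rpow_natCast κ, ← Real.rpow_mul hκ.le,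
    mul_comm ((N + 1 : ℕ) : ℝ), Real.rpow_mul hκ.le, Real.rpow_natCast]
  ring

/-- Solutions that outgrow a prescribed function at a prescribed point. -/
theorem exists_isPosSmoothSolution_not_isBigO (hn : 1 ≤ n) {α lam σ : ℝ} (hα0 : 0 < α)
    (hα : α < (n : ℝ) + 2) (hlam : 0 < lam) (hσ : bigG n α lam < σ) (c : E) {φ : ℝ → ℝ}
    (hφc : ContinuousOn φ (Ioo 0 1)) (hφ : ∀ t ∈ Ioo (0 : ℝ) 1, 0 < φ t) :
    ∃ u : E → ℝ → ℝ, IsPosSmoothSolution α lam σ univ 1 u ∧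
      ¬ (fun t => u c t) =O[𝓝[>] (0 : ℝ)] φ := by
  have hσ0 : 0 < σ := (bigG_nonneg hn hα).trans_lt hσ
  have hn0 : (0 : ℝ) < n := by exact_mod_cast hn
  obtain ⟨a, ha0, han, hap, haσ⟩ := exists_rate hn hlam hσ
  obtain ⟨κ, hκ0, hκ1, hκ⟩ : ∃ κ : ℝ, 0 < κ ∧ κ ≤ 1 / 4 ∧ 8 * κ * (α / n + σ / 2) ≤ 1 := by
    have hA : 0 < α / n + σ / 2 := by positivity
    refine ⟨min (1 / 4) (1 / (8 * (α / n + σ / 2))), by positivity, min_le_left _ _, ?_⟩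
    calc 8 * min (1 / 4) (1 / (8 * (α / n + σ / 2))) * (α / n + σ / 2)
        ≤ 8 * (1 / (8 * (α / n + σ / 2))) * (α / n + σ / 2) := by
          gcongr
          exact min_le_right _ _
      _ = 1 := by field_simp
  have hκ1' : κ < 1 := by linarith
  obtain ⟨C, hC0, hC⟩ := exists_heatOp_atom_le_heatConv hn a hα0 hlam.le hσ0.le hκ0 hκ1 hκ
  set η := (α + a * (lam + σ) - n - 2) / 2 - (a / 2 + 1)
  have hη : 0 < η := by
    simp only [η]
    linarith
  obtain ⟨ρ, hρ0, hρ1, hρ⟩ := exists_scale_tsum_le hκ0 (C := C * κ ^ (-η)) hη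
  have hρj : ∀ j : ℕ, 0 < ρ * κ ^ j ∧ ρ * κ ^ j ≤ 1 / 8 := fun j =>
    ⟨by positivity, (mul_le_of_le_one_right hρ0.le (pow_le_one₀ hκ0.le hκ1'.le)).trans hρ1⟩
  -- The last atom of the `j`-th chain will be complete in this interval whatever the length of the
  -- chain, so the length can be chosen after the bound `M j`.
  have hsup : ∀ j : ℕ, ∃ M, ∀ t ∈ Icc (ρ * κ ^ j) (2 * (ρ * κ ^ j)), φ t ≤ M := fun j => by
    have hsub : Icc (ρ * κ ^ j) (2 * (ρ * κ ^ j)) ⊆ Ioo 0 1 := fun t ht =>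
      ⟨(hρj j).1.trans_le ht.1, by linarith [ht.2, (hρj j).2]⟩
    obtain ⟨M, hM⟩ := (isCompact_Icc.image_of_continuousOn (hφc.mono hsub)).bddAbove
    exact ⟨M, fun t ht => hM (mem_image_of_mem φ ht)⟩
  choose M hM using hsup
  have hlen : ∀ j : ℕ, ∃ N : ℕ, j * M j
      ≤ (20 * Real.pi) ^ (-((n : ℝ) / 2)) * (ρ * κ ^ j * κ ^ (N + 1)) ^ (-(a / 2)) := fun j =>
    exists_chain_length hκ0 hκ1' ha0 (hρj j).1 (by positivity) _
  choose N hN using hlen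
  let ι := {p : ℕ × ℕ // p.2 ≤ N p.1 + 1}
  let R : ι → ℝ := fun i => ρ * κ ^ (i.1.1 + i.1.2)
  let τ : ι → ℝ := fun i => ρ * κ ^ i.1.1 * poleTime κ i.1.2
  have hR : ∀ i, 0 < R i := fun i => by positivity
  have hRle : ∀ i : ι, R i = ρ * κ ^ i.1.1 * κ ^ i.1.2 := fun i => by
    simp only [R]
    ring
  have hτR : ∀ i : ι, τ i + 2 * R i ≤ 2 * (ρ * κ ^ i.1.1) := fun i => by
    have h1 := poleTime_le hκ0 hκ1 i.1.2
    have h2 : 0 < κ ^ i.1.2 := by positivity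
    have h3 := (hρj i.1.1).1
    rw [hRle]
    simp only [τ]
    nlinarith
  have hτR0 : ∀ i : ι, -(2 * R i) ≤ τ i := fun i => by
    have h1 := neg_two_mul_pow_le_poleTime hκ0 i.1.2
    rw [hRle]
    simp only [τ]
    nlinarith [(hρj i.1.1).1]
  have hτabs : ∀ i : ι, |τ i| ≤ 2 * (ρ * κ ^ i.1.1) := fun i => by
    have h1 := neg_two_le_poleTime hκ0 i.1.2
    rw [abs_le]
    constructor
    · simp only [τ]
      nlinarith [(hρj i.1.1).1]
    · linarith [hτR i, hR i]
  have hτ2 : ∀ i : ι, -2 ≤ τ i := fun i => by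
    linarith [neg_abs_le (τ i), hτabs i, (hρj i.1.1).2]
  have htend : Tendsto (fun j : ℕ => 2 * (ρ * κ ^ j)) atTop (𝓝 0) := by
    have := ((tendsto_pow_atTop_nhds_zero_of_lt_one hκ0.le hκ1').const_mul ρ).const_mul 2
    simpa using this
  have hfin : ∀ ε > 0, {i : ι | ¬ (|τ i| < ε ∧ τ i + 2 * R i < ε)}.Finite := fun ε hε => by
    obtain ⟨J, hJ⟩ := eventually_atTop.1 (htend.eventually (gt_mem_nhds hε))
    refine ((Finset.range J ×ˢ Finset.range ((Finset.range J).sup N + 2)).finite_toSet.preimage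
      (f := (Subtype.val : ι → ℕ × ℕ)) Subtype.val_injective.injOn).subset fun i hi => ?_
    have hiJ : i.1.1 < J := by
      by_contra hcon
      have h1 := hJ i.1.1 (not_lt.1 hcon)
      exact hi ⟨(hτabs i).trans_lt h1, (hτR i).trans_lt h1⟩
    have h2 : N i.1.1 ≤ (Finset.range J).sup N := Finset.le_sup (Finset.mem_range.2 hiJ)
    have h3 := i.2
    simp only [mem_preimage, Finset.coe_product, mem_prod, Finset.coe_range, mem_Iio]
    exact ⟨hiJ, by omega⟩
  have hsum : ∀ r : ℝ, 0 < r → Summable fun i => R i ^ r := fun r hr =>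
    (summable_scale hκ0 hκ1' hρ0 hr).subtype _
  -- An atom is charged `C * R' ^ η` with `R'` the scale of its predecessor; the factor `κ ^ (-η)`
  -- expresses this through its own scale.
  let θ : ι → ℝ := fun i => C * κ ^ (-η) * R i ^ η
  have hθ : ∀ s : Finset ι, ∑ i ∈ s, θ i ≤ 1 := fun s => by
    refine le_trans ?_ hρ
    rw [← Finset.mul_sum]
    refine mul_le_mul_of_nonneg_left ?_ (by positivity)
    have h1 := (summable_scale hκ0 hκ1' hρ0 hη).sum_le_tsum
      (s.map ⟨Subtype.val, Subtype.val_injective⟩) fun p _ => by positivity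
    rwa [Finset.sum_map] at h1
  have hstep : ∀ i : ι, ∀ u : E → ℝ → ℝ,
      (∀ i, ∀ x, ∀ t ∈ Ioo (0 : ℝ) 1, atom a c (R i) (τ i) x t ≤ u x t) → ∀ x,
      ∀ t ∈ Ioo (0 : ℝ) 1, ENNReal.ofReal (heatOp (atom a c (R i) (τ i)) x t)
        ≤ ENNReal.ofReal (θ i) * (heatConv α lam 1 u x t * ENNReal.ofReal (u x t ^ σ)) := by
    rintro ⟨⟨j, k⟩, hi⟩ u hu x t ht
    -- The first atom of a chain has its pole at time `-2 * R`, so its source lives at times at most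
    -- `0` and costs nothing in the slab. Every later atom is paid for by its predecessor.
    rcases k with _ | k
    · rw [heatOp_atom_eq_zero (hR _)]
      · simp
      · have : τ ⟨(j, 0), hi⟩ = -(2 * R ⟨(j, 0), hi⟩) := by
          simp only [τ, R, poleTime, add_zero]
          ring
        rw [this, mem_Icc, not_and_or, not_le, not_le]
        right
        linarith [ht.1]
    · let i' : ι := ⟨(j, k), by simp only at hi ⊢; omega⟩
      have hRi : R ⟨(j, k + 1), hi⟩ = κ * R i' := by
        simp only [R, i']
        ring
      have hτi : τ ⟨(j, k + 1), hi⟩ = τ i' + 3 * R i' := by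
        simp only [τ, R, i', poleTime]
        ring
      have hθi : θ ⟨(j, k + 1), hi⟩ = C * R i' ^ η := by
        simp only [θ]
        rw [hRi, Real.mul_rpow hκ0.le (hR i').le, Real.rpow_neg hκ0.le]
        field_simp
      rw [hRi, hτi, hθi]
      exact hC c (R i') (τ i') (hR i') (hτR0 i') u (hu i') x t ht
  -- Positivity comes from the atom with index `(0, 0)`, which is fully switched on at time `0`.
  have hsol := isPosSmoothSolution_tsum_atom (α := α) (σ := σ) (θ := θ) c hlam han hap hR hsum hτ2
    hfin ⟨⟨(0, 0), Nat.zero_le _⟩, by simp [τ, R, poleTime, mul_comm]⟩ (fun i => by positivity) hθ hstep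
  refine ⟨_, hsol, fun hO => ?_⟩
  let e : ℕ → ι := fun j => ⟨(j, N j + 1), le_rfl⟩
  let T : ℕ → ℝ := fun j => τ (e j) + 2 * R (e j)
  have hT : ∀ j, T j ∈ Icc (ρ * κ ^ j) (2 * (ρ * κ ^ j)) := fun j => by
    refine ⟨?_, hτR (e j)⟩
    have h1 := one_le_poleTime_succ hκ0 (N j)
    have h2 : ρ * κ ^ j ≤ τ (e j) := by
      simp only [τ, e]
      nlinarith [(hρj j).1]
    linarith [hR (e j)]
  have hT01 : ∀ j, T j ∈ Ioo (0 : ℝ) 1 := fun j =>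
    ⟨(hρj j).1.trans_le (hT j).1, by linarith [(hT j).2, (hρj j).2]⟩
  have hT0 : Tendsto T atTop (𝓝[>] 0) :=
    tendsto_nhdsWithin_iff.2 ⟨squeeze_zero (fun j => (hT01 j).1.le) (fun j => (hT j).2) htend,
      Eventually.of_forall fun j => (hT01 j).1⟩
  have hlow : ∀ j : ℕ, j * φ (T j) ≤ ∑' i, atom a c (R i) (τ i) c (T j) := fun j => by
    have hTj : T j = τ (e j) + 2 * R (e j) := rfl
    have h1 : (20 * Real.pi) ^ (-((n : ℝ) / 2)) * R (e j) ^ (-(a / 2))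
        * Real.exp (-(‖c - c‖ ^ 2 / (2 * R (e j)))) ≤ atom a c (R (e j)) (τ (e j)) c (T j) :=
      le_atom (hR _) hTj.ge (by linarith [hR (e j)]) c
    have h2 : atom a c (R (e j)) (τ (e j)) c (T j) ≤ ∑' i, atom a c (R i) (τ i) c (T j) :=
      (summable_atom hR (hsum _ (by linarith)) hfin c (hT01 j).1).le_tsum (e j)
        fun i _ => atom_nonneg (hR i) _ _
    have h3 := hN j
    have hRe : R (e j) = ρ * κ ^ j * κ ^ (N j + 1) := hRle (e j)
    rw [← hRe] at h3
    simp only [sub_self, norm_zero, ne_eq, OfNat.ofNat_ne_zero, not_false_eq_true, zero_pow,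
      zero_div, neg_zero, Real.exp_zero, mul_one] at h1
    have h4 : (j : ℝ) * φ (T j) ≤ j * M j :=
      mul_le_mul_of_nonneg_left (hM j _ (hT j)) (Nat.cast_nonneg j)
    linarith
  obtain ⟨K, hK⟩ := hO.bound
  -- At `T j` the solution is at least `j * φ (T j)`, so any `j > K` refutes the constant `K`.
  obtain ⟨j, hj1, hj2⟩ := ((hT0.eventually hK).and
    (tendsto_natCast_atTop_atTop.eventually (eventually_gt_atTop K))).exists
  have hφj := hφ _ (hT01 j)
  rw [Real.norm_of_nonneg hφj.le] at hj1
  have := (hlow j).trans ((le_abs_self _).trans hj1)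
  exact absurd (le_of_mul_le_mul_right this hφj) (not_le.2 hj2)

end Choquard

theorem theorem1p3 (n : ℕ) (hn : 1 ≤ n) (α lam σ : ℝ)
    (hα : α ∈ Set.Ioo (0 : ℝ) ((n : ℝ) + 2)) (hlam : 0 < lam)
    (hσ : Choquard.bigG n α lam < σ) :
    (∀ φ : ℝ → ℝ, ContinuousOn φ (Set.Ioo 0 1) → (∀ t ∈ Set.Ioo (0 : ℝ) 1, 0 < φ t) →
      Filter.Tendsto φ (𝓝[>] (0 : ℝ)) Filter.atTop →
      ∃ u : EuclideanSpace ℝ (Fin n) → ℝ → ℝ,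
        Choquard.IsPosSmoothSolution α lam σ Set.univ 1 u ∧
        ¬ (fun t => u 0 t) =O[𝓝[>] (0 : ℝ)] φ) ∧
    (∀ Ω : Set (EuclideanSpace ℝ (Fin n)), IsOpen Ω → Ω.Nonempty →
      ¬ ∃ φ : ℝ → ℝ, ContinuousOn φ (Set.Ioo 0 1) ∧ (∀ t ∈ Set.Ioo (0 : ℝ) 1, 0 < φ t) ∧
        ∀ u : EuclideanSpace ℝ (Fin n) → ℝ → ℝ,
          Choquard.IsPosSmoothSolution α lam σ Ω 1 u →
          ∀ K : Set (EuclideanSpace ℝ (Fin n)), IsCompact K → K ⊆ Ω →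
            Choquard.IsBoundOn φ K u) := by
  obtain ⟨hα0, hα2⟩ := hα
  refine ⟨fun φ hc hp _ =>
    Choquard.exists_isPosSmoothSolution_not_isBigO hn hα0 hα2 hlam hσ 0 hc hp, ?_⟩
  rintro Ω - ⟨c, hc⟩ ⟨φ, hφc, hφ, h⟩
  obtain ⟨u, hu, hO⟩ :=
    Choquard.exists_isPosSmoothSolution_not_isBigO hn hα0 hα2 hlam hσ c hφc hφ
  have hu' : Choquard.IsPosSmoothSolution α lam σ Ω 1 u :=
    ⟨hu.smooth, hu.pos, hu.memLp, fun x _ => hu.heatOp_nonneg x (Set.mem_univ x),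
      fun x _ => hu.heatOp_le x (Set.mem_univ x)⟩
  obtain ⟨C, hC⟩ := h u hu' {c} isCompact_singleton (Set.singleton_subset_iff.2 hc)
  refine hO (Asymptotics.IsBigO.of_bound C ?_)
  filter_upwards [hC, Ioo_mem_nhdsGT (zero_lt_one' ℝ)] with t ht ht01
  rw [Real.norm_of_nonneg (hu.pos c t ht01).le, Real.norm_of_nonneg (hφ t ht01).le]
  exact ht c rfl
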